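/- Let $(X,d_X)$ be a metric space with Borel $\sigma$-field $\mathcal A$, $\mu$ a probability measure on $\mathcal A$, $T:X\to X$ an ergodic $\mu$-preserving map, and $\xi$ a countable partition (mod $\mu$) of $X$ into open sets such that for each $Z\in\xi$ the restriction $T|_Z$ is a homeomorphism onto $TZ$. Let $\xi_n$ be the family of cylinders $\bigcap_{i=0}^{n-1}T^{-i}Z_i$ with $Z_i\in\xi$; for $Z\in\xi_n$ let $v_Z:=(T^n|_Z)^{-1}:T^nZ\to Z$ and $v_Z':=d(\mu\circ v_Z)/d\mu$. Assume that $(X,\mathcal A,\mu,T,\xi)$ is Gibbs–Markov, that is: * (Markov) if $Z,Z'\in\xi$ and $TZ\cap Z'\neq\varnothing$, then $Z'\subseteq TZ$; * $\operatorname{diam}(X)<\infty$, and there are $N\ge1$ and $\rho\in(0,1)$ with $d_X(x,y)\le\rho\, d_X(T^Nx,T^Ny)$ whenever $x,y\in Z\in\xi_N$; * (big images) $\inf_{Z\in\xi}\mu(TZ)>0$; * there are $r>0$ and positive versions of the $v_Z'$, $Z\in\xi$, with $|v_Z'(x)/v_Z'(y)-1|\le r\,d_X(x,y)$ for all $x,y\in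 TZ$, $Z\in\xi$. For measurable $A$ with $\mu(A)>0$ let $\mu_A:=\mu(A\cap\cdot)/\mu(A)$, $\varphi_A(x):=\inf\{n\ge1:T^nx\in A\}$, $T_Ax:=T^{\varphi_A(x)}x$ (defined $\mu$-a.e.), and $\Phi_A:=(\varphi_A,\varphi_A\circ T_A,\varphi_A\circ T_A^2,\dots)$. For probability measures $\nu_l$, write $\mu(A_l)\Phi_{A_l}\overset{\nu_l}{\Longrightarrow}\Phi$ if the laws of $\mu(A_l)\Phi_{A_l}$ under $\nu_l$ converge weakly, in the compact product space $[0,\infty]^{\mathbb N_0}$, to the law of $\Phi$. Let $x^*\in X$ be a point such that for every $l\ge1$ the cylinder $A_l:=\xi_l(x^*)$, i.e. the element of $\xi_l$ containing $x^*$, is defined. **a)** If $x^*$ is not periodic, then $(A_l)$ exhibits Poisson asymptotics: $$\mu(A_l)\Phi_{A_l}\overset{\mu}{\Longrightarrow}\Phi_{\mathrm{Exp}}\quad\text{and}\quad\mu(A_l)\Phi_{A_l}\overset{\mu_{A_l}}{\Longrightarrow}\Phi_{\mathrm{Exp}}\qquad(l\to\infty),$$ where $\Phi_{\mathrm{Exp}}$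 is an iid sequence of exponentially distributed random variables with mean $1$. **b)** If $x^*$ is periodic with minimal period $p\ge1$ and $\mu(\{x^*\})=0$, then $v_{A_p}'$ has a positive version that is continuous on $T^pA_p$. For every such version, $\theta:=1-v_{A_p}'(x^*)\in(0,1)$, and $$\mu(A_l)\Phi_{A_l}\overset{\mu_{A_l}}{\Longrightarrow}\widetilde\Phi_{(\mathrm{Exp},\theta)}\qquad(l\to\infty),$$ where $\widetilde\Phi_{(\mathrm{Exp},\theta)}$ is an iid sequence of random variables with distribution function $\widetilde F_{(\mathrm{Exp},\theta)}(t)=(1-\theta)+\theta(1-e^{-\theta t})$, $t\ge0$. -/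

import Mathlib

open MeasureTheory ProbabilityTheory Filter Topology Set
open scoped ENNReal

noncomputable section

namespace RareEvents

/-! ### Hitting times and hitting-time processes -/

/-- The first hitting time `φ_A(x) = inf {n ≥ 1 : T^n x ∈ A} ∈ {1, 2, …, ∞}`. -/
def hitTime {X : Type*} (T : X → X) (A : Set X) (x : X) : ℕ∞ :=
  sInf {m : ℕ∞ | ∃ n : ℕ, 1 ≤ n ∧ T^[n] x ∈ A ∧ m = (n : ℕ∞)}

/-- The first entrance map `T_A x = T^{φ_A(x)} x`. On the set `φ_A = ∞`, which is null for an
ergodic probability preserving `T` and a set `A` of positive measure, we put `T_A x = x`. -/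
def entranceMap {X : Type*} (T : X → X) (A : Set X) (x : X) : X :=
  T^[(hitTime T A x).toNat] x

/-- The normalized hitting-time process
`μ(A) Φ_A = μ(A) (φ_A, φ_A ∘ T_A, φ_A ∘ T_A², …)`, with values in `[0, ∞]^ℕ`. -/
def hitProcess {X : Type*} [MeasurableSpace X] (μ : Measure X) (T : X → X) (A : Set X) (x : X) :
    ℕ → ℝ≥0∞ :=
  fun j => μ A * ((hitTime T A ((entranceMap T A)^[j] x) : ℕ∞) : ℝ≥0∞)

/-! ### Distributional convergence and the limit laws -/

/-- `R_l ⟹ Q` under `ν_l`: the laws `ν_l ∘ R_l⁻¹` converge weakly to the probability `Q` on the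
compact metrizable space `E`. -/
def ConvergesInLaw {X E : Type*} [MeasurableSpace X] [TopologicalSpace E] [MeasurableSpace E]
    (ν : ℕ → Measure X) (R : ℕ → X → E) (Q : Measure E) : Prop :=
  ∀ χ : C(E, ℝ),
    Tendsto (fun l => ∫ e, χ e ∂((ν l).map (R l))) atTop (𝓝 (∫ e, χ e ∂Q))

/-- The exponential distribution with parameter `r`, as a measure on `[0, ∞]`. -/
def expLaw (r : ℝ) : Measure ℝ≥0∞ := (expMeasure r).map ENNReal.ofReal

/-- The law on `[0, ∞]` with distribution function
`t ↦ (1 - θ) + θ (1 - exp (-θ t))` for `t ≥ 0`, where `θ ∈ (0, 1)`. -/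
def compoundExpLaw (θ : ℝ) : Measure ℝ≥0∞ :=
  ENNReal.ofReal (1 - θ) • Measure.dirac 0 + ENNReal.ofReal θ • expLaw θ

/-- The law on `[0, ∞]^ℕ` of an iid sequence with marginal law `Q`. -/
def iidLaw (Q : Measure ℝ≥0∞) : Measure (ℕ → ℝ≥0∞) := Measure.infinitePi fun _ => Q

/-- `(A_l)` exhibits Poisson asymptotics: the normalized hitting-time processes (under `μ`) and the
normalized return-time processes (under `μ_{A_l}`) converge to an iid sequence of standard
exponential variables. -/
def PoissonAsymptotics {X : Type*} [MeasurableSpace X] (μ : Measure X) (T : X → X)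
    (A : ℕ → Set X) : Prop :=
  ConvergesInLaw (fun _ => μ) (fun l => hitProcess μ T (A l)) (iidLaw (expLaw 1)) ∧
  ConvergesInLaw (fun l => μ[|A l]) (fun l => hitProcess μ T (A l)) (iidLaw (expLaw 1))

/-! ### Piecewise invertible systems and Gibbs-Markov maps -/

/-- The family `ξ_n` of cylinders of rank `n`, that is, of the sets
`[Z_0, …, Z_{n-1}] = ⋂_{i < n} T^{-i} Z_i` with `Z_i ∈ ξ`. -/
def cylinders {X : Type*} (T : X → X) (ξ : Set (Set X)) (n : ℕ) : Set (Set X) :=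
  {Z | ∃ c : Fin n → Set X, (∀ i, c i ∈ ξ) ∧ Z = ⋂ i : Fin n, T^[(i : ℕ)] ⁻¹' c i}

/-- `ξ` is a countable partition mod `μ` into open sets, and each branch `T|_Z`, `Z ∈ ξ`, is a
homeomorphism onto its image `T Z`, null-preserving with respect to `μ`. -/
structure IsPiecewiseInvertible {X : Type*} [MetricSpace X] [MeasurableSpace X]
    (μ : Measure X) (T : X → X) (ξ : Set (Set X)) : Prop where
  countable : ξ.Countable
  isOpen : ∀ Z ∈ ξ, IsOpen Z
  disjoint : ξ.PairwiseDisjoint id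
  cover : μ (⋃₀ ξ)ᶜ = 0
  homeo : ∀ Z ∈ ξ, IsEmbedding (Z.domRestrict T)
  nullPreserving : ∀ Z ∈ ξ, (μ.restrict Z).map T ≪ μ

/-- `w` is a positive version, on `T^n Z`, of the Radon-Nikodym derivative
`v_Z' = d(μ ∘ v_Z)/dμ` of the inverse branch `v_Z = (T^n|_Z)⁻¹ : T^n Z → Z`.
Note that `v_Z(B) = Z ∩ T^{-n} B` for `B ⊆ T^n Z`. -/
def IsInverseBranchDeriv {X : Type*} [MeasurableSpace X] (μ : Measure X) (T : X → X) (n : ℕ)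
    (Z : Set X) (w : X → ℝ) : Prop :=
  (∀ x ∈ T^[n] '' Z, 0 < w x) ∧
  ∀ B, MeasurableSet B → B ⊆ T^[n] '' Z →
    μ (Z ∩ T^[n] ⁻¹' B) = ∫⁻ x in B, ENNReal.ofReal (w x) ∂μ

/-- Ergodic probability preserving Gibbs-Markov systems `(X, 𝓑_X, μ, T, ξ)`. -/
structure IsErgodicGibbsMarkov {X : Type*} [MetricSpace X] [MeasurableSpace X]
    (μ : Measure X) (T : X → X) (ξ : Set (Set X)) : Prop where
  isProbability : IsProbabilityMeasure μ
  ergodic : Ergodic T μ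
  piecewiseInvertible : IsPiecewiseInvertible μ T ξ
  markov : ∀ Z ∈ ξ, ∀ Z' ∈ ξ, (T '' Z ∩ Z').Nonempty → Z' ⊆ T '' Z
  bounded : Bornology.IsBounded (univ : Set X)
  /-- some iterate `T^N` is uniformly expanding on the cylinders of rank `N` -/
  expanding : ∃ N : ℕ, 1 ≤ N ∧ ∃ ρ : ℝ, 0 < ρ ∧ ρ < 1 ∧
    ∀ Z ∈ cylinders T ξ N, ∀ x ∈ Z, ∀ y ∈ Z, dist x y ≤ ρ * dist (T^[N] x) (T^[N] y)
  /-- the images `T Z` have measure bounded below -/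
  bigImage : ∃ b : ℝ≥0∞, 0 < b ∧ ∀ Z ∈ ξ, b ≤ μ (T '' Z)
  /-- the derivatives `v_Z'`, `Z ∈ ξ`, have uniformly well behaved versions -/
  regular : ∃ r : ℝ, 0 < r ∧ ∀ Z ∈ ξ, ∃ w : X → ℝ, IsInverseBranchDeriv μ T 1 Z w ∧
    ∀ x ∈ T '' Z, ∀ y ∈ T '' Z, |w x / w y - 1| ≤ r * dist x y

end RareEvents

end

open RareEvents

/-! For a list `s :: L` of natural exponents let H(s :: L) be the Laplace transform of the
normalized hitting process under μ, and R(s :: L) that of the return process under μ_{A_l}. By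
Stone–Weierstrass the monomials in exp(-h_i) span a dense subspace of C([0,∞]^ℕ), so convergence in
law only requires convergence of these transforms (`tendsto_integral_of_laplaceMonomial`).

Two relations determine the limit. The first is exact and only uses T-invariance of μ: with a =
μ(A_l), ((e^{sa} - 1)/a) H(s :: L) = R(L) - R(s :: L) (`laplace_hitting_return`). The second is
asymptotic: R(s :: L) ≈ (1-θ) R(L) + θ H(s :: L), with θ = 1 at a non-periodic point and 1-θ =
v'(x*) at a periodic one. As a → 0 they combine to (s+θ) R(s :: L) ≈ (s(1-θ)+θ) R(L). The quotient
(1-θ) + θ·θ/(s+θ) is the Laplace transform of the limiting marginal, and induction on the list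
yields the iid law (`tendsto_return_laplace`).

For the second relation, discard from A_l the points returning after exactly the period p, which
asymptotically are A_{p+l}. The remaining points rarely return within l steps: fixed return times
are excluded by the geometry, and later ones are controlled by the summability of μ(A_j)
(`tendsto_short_returns`). Since also l μ(A_l) → 0, the process may be restarted at time l. By
bounded distortion the T^l-image of the normalized remainder has bounded, uniformly slowly varying
density, while the Laplace functional is asymptotically T-invariant. By ergodicity such functionals
decorrelate from every fixed event, so they see only the mass θ of the image
(`tendsto_integral_sub_of_slowly_varying`, `HasCylinderBounds.tendsto_setIntegral_laplaceMonomial`).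
On A_{p+l}, T^p maps onto A_l with inverse-branch density close to v'(x*), which gives the term
(1-θ) R(L). -/

noncomputable section

namespace RareEvents

section

/-! ### The Laplace kernel on `[0, ∞]` -/

/-- The function `h ↦ exp (-h)` on `[0, ∞]`. -/
def expNeg (h : ℝ≥0∞) : ℝ := (EReal.exp (-(h : EReal))).toReal

lemma exp_neg_coe_le_one (h : ℝ≥0∞) : EReal.exp (-(h : EReal)) ≤ 1 := by
  rw [EReal.exp_le_one_iff, EReal.neg_le, neg_zero]
  exact EReal.coe_ennreal_nonneg h

lemma exp_neg_coe_ne_top (h : ℝ≥0∞) : EReal.exp (-(h : EReal)) ≠ ∞ :=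
  ((exp_neg_coe_le_one h).trans_lt ENNReal.one_lt_top).ne

lemma expNeg_nonneg (h : ℝ≥0∞) : 0 ≤ expNeg h := ENNReal.toReal_nonneg

lemma expNeg_le_one (h : ℝ≥0∞) : expNeg h ≤ 1 :=
  ENNReal.toReal_le_of_le_ofReal zero_le_one (by simpa using exp_neg_coe_le_one h)

lemma continuous_expNeg : Continuous expNeg := by
  have h1 : Continuous fun h : ℝ≥0∞ => EReal.exp (-(h : EReal)) :=
    EReal.expHomeomorph.continuous.comp (continuous_neg.comp continuous_coe_ennreal_ereal)
  exact ENNReal.continuousOn_toReal.comp_continuous h1 exp_neg_coe_ne_top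

lemma expNeg_injective : Function.Injective expNeg := by
  intro a b hab
  have h := (ENNReal.toReal_eq_toReal_iff' (exp_neg_coe_ne_top a) (exp_neg_coe_ne_top b)).1 hab
  have h2 := EReal.exp_strictMono.injective h
  simpa using h2

lemma expNeg_add (a b : ℝ≥0∞) : expNeg (a + b) = expNeg a * expNeg b := by
  unfold expNeg
  rw [← ENNReal.toReal_mul, ← EReal.exp_add]
  congr 2
  rw [EReal.coe_ennreal_add, EReal.neg_add, sub_eq_add_neg]
  · left; simp
  · right; simp

lemma expNeg_ofReal {x : ℝ} (hx : 0 ≤ x) : expNeg (ENNReal.ofReal x) = Real.exp (-x) := by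
  unfold expNeg
  rw [EReal.coe_ennreal_ofReal, max_eq_left hx, ← EReal.coe_neg, EReal.exp_coe,
    ENNReal.toReal_ofReal (Real.exp_nonneg _)]

lemma expNeg_of_ne_top {a : ℝ≥0∞} (ha : a ≠ ∞) : expNeg a = Real.exp (-a.toReal) := by
  rw [← expNeg_ofReal ENNReal.toReal_nonneg, ENNReal.ofReal_toReal ha]

lemma expNeg_top : expNeg ∞ = 0 := by simp [expNeg]

lemma expNeg_zero : expNeg 0 = 1 := by simp [expNeg]

/-- The function `h ↦ exp (-(s_0 h_0 + s_1 h_1 + …))` on `[0, ∞]^ℕ` for a finite list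
`s_0, s_1, …` of exponents. -/
def laplaceMonomial : List ℕ → (ℕ → ℝ≥0∞) → ℝ
  | [], _ => 1
  | s :: L, h => expNeg (h 0) ^ s * laplaceMonomial L (fun j => h (j + 1))

lemma continuous_laplaceMonomial (L : List ℕ) : Continuous (laplaceMonomial L) := by
  induction L with
  | nil => exact continuous_const
  | cons s L ih =>
    exact ((continuous_expNeg.comp (continuous_apply 0)).pow s).mul
      (ih.comp (by fun_prop))

lemma laplaceMonomial_nonneg (L : List ℕ) (h : ℕ → ℝ≥0∞) : 0 ≤ laplaceMonomial L h := by
  induction L generalizing h with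
  | nil => exact zero_le_one
  | cons s L ih => exact mul_nonneg (pow_nonneg (expNeg_nonneg _) _) (ih _)

lemma laplaceMonomial_le_one (L : List ℕ) (h : ℕ → ℝ≥0∞) : laplaceMonomial L h ≤ 1 := by
  induction L generalizing h with
  | nil => exact le_rfl
  | cons s L ih =>
    exact mul_le_one₀ (pow_le_one₀ (expNeg_nonneg _) (expNeg_le_one _))
      (laplaceMonomial_nonneg _ _) (ih _)

lemma laplaceMonomial_const_top (s : ℕ) (L : List ℕ) :
    laplaceMonomial (s :: L) (fun _ => ∞) = 0 ^ s * laplaceMonomial L (fun _ => ∞) := by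
  simp [laplaceMonomial, expNeg_top]

/-! ### First hitting times -/

section Hitting

variable {X : Type*} {T : X → X} {A : Set X} {x : X}

lemma hitTime_le {n : ℕ} (hn : 1 ≤ n) (h : T^[n] x ∈ A) : hitTime T A x ≤ n :=
  sInf_le ⟨n, hn, h, rfl⟩

lemma hitTime_eq_coe {n : ℕ} (hn : 1 ≤ n) (h : T^[n] x ∈ A)
    (h' : ∀ m, 1 ≤ m → m < n → T^[m] x ∉ A) : hitTime T A x = n := by
  refine le_antisymm (hitTime_le hn h) (le_sInf ?_)
  rintro _ ⟨m, hm, hmA, rfl⟩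
  by_contra hlt
  exact h' m hm (by exact_mod_cast not_le.1 hlt) hmA

lemma hitTime_eq_top (h : ∀ n, 1 ≤ n → T^[n] x ∉ A) : hitTime T A x = ⊤ := by
  refine top_unique (le_sInf ?_)
  rintro _ ⟨m, hm, hmA, rfl⟩
  exact (h m hm hmA).elim

lemma hitTime_cases (T : X → X) (A : Set X) (x : X) :
    (∃ n : ℕ, 1 ≤ n ∧ T^[n] x ∈ A ∧ (∀ m, 1 ≤ m → m < n → T^[m] x ∉ A) ∧
      hitTime T A x = n) ∨
    ((∀ n, 1 ≤ n → T^[n] x ∉ A) ∧ hitTime T A x = ⊤) := by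
  classical
  by_cases h : ∃ n, 1 ≤ n ∧ T^[n] x ∈ A
  · left
    have h1 := Nat.find_spec h
    have h2 : ∀ m, 1 ≤ m → m < Nat.find h → T^[m] x ∉ A :=
      fun m hm hlt hmA => Nat.find_min h hlt ⟨hm, hmA⟩
    exact ⟨Nat.find h, h1.1, h1.2, h2, hitTime_eq_coe h1.1 h1.2 h2⟩
  · right
    push Not at h
    exact ⟨h, hitTime_eq_top h⟩

lemma hitTime_of_mem (h : T x ∈ A) : hitTime T A x = 1 :=
  hitTime_eq_coe (n := 1) le_rfl h (fun m h1 h2 => by omega)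

lemma entranceMap_of_mem (h : T x ∈ A) : entranceMap T A x = T x := by
  simp [entranceMap, hitTime_of_mem h]

lemma hitTime_of_notMem (h : T x ∉ A) : hitTime T A x = hitTime T A (T x) + 1 := by
  rcases hitTime_cases T A (T x) with ⟨n, hn, hnA, hmin, heq⟩ | ⟨hno, heq⟩
  · rw [heq]
    refine hitTime_eq_coe (n := n + 1) (by omega) hnA ?_
    rintro (_ | _ | m) h1 h2
    · omega
    · exact h
    · exact hmin (m + 1) (by omega) (by omega)
  · rw [heq, top_add]
    refine hitTime_eq_top ?_
    rintro (_ | _ | m) h1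
    · omega
    · exact h
    · exact hno (m + 1) (by omega)

lemma entranceMap_of_notMem (h : T x ∉ A) (hfin : hitTime T A (T x) ≠ ⊤) :
    entranceMap T A x = entranceMap T A (T x) := by
  unfold entranceMap
  rw [hitTime_of_notMem h]
  lift hitTime T A (T x) to ℕ using hfin with n
  rfl

variable [MeasurableSpace X] {μ : Measure X}

lemma hitProcess_zero (μ : Measure X) (T : X → X) (A : Set X) (x : X) :
    hitProcess μ T A x 0 = μ A * ((hitTime T A x : ℕ∞) : ℝ≥0∞) := rfl

lemma hitProcess_succ (μ : Measure X) (T : X → X) (A : Set X) (x : X) (j : ℕ) :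
    hitProcess μ T A x (j + 1) = hitProcess μ T A (entranceMap T A x) j := rfl

/-- The convention that `entranceMap` fixes points with infinite hitting time keeps all later
coordinates infinite. Positivity of μ(A) matters because 0 · ∞ = 0 in `ℝ≥0∞`. -/
lemma hitProcess_of_top (hA : μ A ≠ 0) (h : hitTime T A x = ⊤) :
    hitProcess μ T A x = fun _ => ∞ := by
  have hx : entranceMap T A x = x := by simp [entranceMap, h]
  funext j
  have : (entranceMap T A)^[j] x = x := Function.iterate_fixed hx j
  simp [hitProcess, this, h, ENNReal.mul_top hA]

lemma laplaceMonomial_hitProcess_of_mem (s : ℕ) (L : List ℕ) (h : T x ∈ A) :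
    laplaceMonomial (s :: L) (hitProcess μ T A x) =
      expNeg (μ A) ^ s * laplaceMonomial L (hitProcess μ T A (T x)) := by
  simp only [laplaceMonomial, hitProcess_zero, hitProcess_succ, hitTime_of_mem h,
    entranceMap_of_mem h]
  simp

/-- If T x misses A, the first waiting time drops by one and the later ones are unchanged. If A is
never hit, both processes are constantly ∞, and the factor is harmless: it is 1 for s = 0, while
both sides vanish for s > 0. -/
lemma laplaceMonomial_hitProcess_of_notMem (hA : μ A ≠ 0) (L : List ℕ) (s : ℕ) (h : T x ∉ A) :
    laplaceMonomial (s :: L) (hitProcess μ T A x) =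
      expNeg (μ A) ^ s * laplaceMonomial (s :: L) (hitProcess μ T A (T x)) := by
  by_cases hfin : hitTime T A (T x) = ⊤
  · have h2 : hitTime T A x = ⊤ := by rw [hitTime_of_notMem h, hfin, top_add]
    rw [hitProcess_of_top hA hfin, hitProcess_of_top hA h2, laplaceMonomial_const_top]
    rcases Nat.eq_zero_or_pos s with rfl | hs
    · simp
    · simp [zero_pow hs.ne']
  · simp only [laplaceMonomial, hitProcess_zero, hitProcess_succ, hitTime_of_notMem h,
      entranceMap_of_notMem h hfin]
    rw [← mul_assoc, ← mul_pow, ← expNeg_add]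
    simp [mul_add, add_comm]

lemma laplaceMonomial_hitProcess_iterate (hA : μ A ≠ 0) (L : List ℕ) (s : ℕ) {n : ℕ}
    (h : ∀ m, 1 ≤ m → m ≤ n → T^[m] x ∉ A) :
    laplaceMonomial (s :: L) (hitProcess μ T A x) =
      (expNeg (μ A) ^ s) ^ n * laplaceMonomial (s :: L) (hitProcess μ T A (T^[n] x)) := by
  induction n with
  | zero => simp
  | succ n ih =>
    rw [ih fun m h1 h2 => h m h1 (by omega), laplaceMonomial_hitProcess_of_notMem hA L s
      (x := T^[n] x) (by rw [← Function.iterate_succ_apply' T]; exact h _ (by omega) le_rfl),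
      ← Function.iterate_succ_apply' T, pow_succ, mul_assoc]

lemma laplaceMonomial_hitProcess_first (hA : μ A ≠ 0) (L : List ℕ) (s : ℕ) {n : ℕ} (hn : 1 ≤ n)
    (h : ∀ m, 1 ≤ m → m < n → T^[m] x ∉ A) (hmem : T^[n] x ∈ A) :
    laplaceMonomial (s :: L) (hitProcess μ T A x) =
      (expNeg (μ A) ^ s) ^ n * laplaceMonomial L (hitProcess μ T A (T^[n] x)) := by
  obtain ⟨k, rfl⟩ : ∃ k, n = k + 1 := ⟨n - 1, by omega⟩
  rw [laplaceMonomial_hitProcess_iterate hA L s (n := k) fun m h1 h2 => h m h1 (by omega),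
    laplaceMonomial_hitProcess_of_mem s L (x := T^[k] x)
      (by rw [← Function.iterate_succ_apply' T]; exact hmem),
    ← Function.iterate_succ_apply' T, pow_succ, mul_assoc]

lemma measurable_hitTime (hT : Measurable T) (hA : MeasurableSet A) :
    Measurable (hitTime T A) := by
  have hlt : ∀ a : ℕ∞, hitTime T A ⁻¹' Iio a =
      ⋃ (n : ℕ) (_ : 1 ≤ n ∧ (n : ℕ∞) < a), T^[n] ⁻¹' A := by
    intro a
    ext x
    simp only [mem_preimage, mem_Iio, hitTime, sInf_lt_iff, mem_ofPred_eq, mem_iUnion]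
    constructor
    · rintro ⟨_, ⟨n, h1, h2, rfl⟩, h3⟩
      exact ⟨n, ⟨h1, h3⟩, h2⟩
    · rintro ⟨n, ⟨h1, h3⟩, h2⟩
      exact ⟨n, ⟨n, h1, h2, rfl⟩, h3⟩
  have hm : ∀ a, MeasurableSet (hitTime T A ⁻¹' Iio a) := fun a => by
    rw [hlt]
    exact .iUnion fun n => .iUnion fun _ => hT.iterate n hA
  refine measurable_to_countable' fun a => ?_
  induction a with
  | top => convert (hm ⊤).compl using 1; ext; simp
  | coe n =>
    convert (hm (n + 1)).diff (hm n) using 1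
    ext x
    simp only [mem_preimage, mem_singleton_iff, Set.mem_sdiff, mem_Iio, not_lt,
      ENat.lt_add_one_iff (ENat.natCast_ne_top n)]
    exact le_antisymm_iff

lemma measurable_entranceMap (hT : Measurable T) (hA : MeasurableSet A) :
    Measurable (entranceMap T A) := by
  have h : Measurable fun x => (hitTime T A x).toNat :=
    (measurable_from_top (f := ENat.toNat)).comp (measurable_hitTime hT hA)
  exact (measurable_from_prod_countable_right (f := fun q : ℕ × X => T^[q.1] q.2)
    fun n => hT.iterate n).comp (h.prodMk measurable_id)

lemma measurable_hitProcess (μ : Measure X) (hT : Measurable T) (hA : MeasurableSet A) :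
    Measurable (hitProcess μ T A) := by
  refine measurable_pi_lambda _ fun j => ?_
  refine Measurable.const_mul ?_ _
  exact (measurable_from_top (f := fun n : ℕ∞ => (n : ℝ≥0∞))).comp
    ((measurable_hitTime hT hA).comp ((measurable_entranceMap hT hA).iterate j))

lemma measurable_laplaceMonomial_hitProcess (μ : Measure X) (hT : Measurable T)
    (hA : MeasurableSet A) (L : List ℕ) :
    Measurable fun x => laplaceMonomial L (hitProcess μ T A x) :=
  (continuous_laplaceMonomial L).measurable.comp (measurable_hitProcess μ hT hA)

lemma integrable_laplaceMonomial_hitProcess (μ ν : Measure X) [IsFiniteMeasure ν]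
    (hT : Measurable T) (hA : MeasurableSet A) (L : List ℕ) :
    Integrable (fun x => laplaceMonomial L (hitProcess μ T A x)) ν := by
  refine Integrable.of_bound (measurable_laplaceMonomial_hitProcess μ hT hA L).aestronglyMeasurable
    1 (ae_of_all _ fun x => ?_)
  rw [Real.norm_of_nonneg (laplaceMonomial_nonneg _ _)]
  exact laplaceMonomial_le_one _ _

/-- The relation between the Laplace transforms of the hitting-time process and of the return-time
process. -/
lemma laplace_hitting_return [IsFiniteMeasure μ] (hT : MeasurePreserving T μ μ)
    (hA : MeasurableSet A) (h0 : μ A ≠ 0) (s : ℕ) (L : List ℕ) :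
    (1 - expNeg (μ A) ^ s) * ∫ x, laplaceMonomial (s :: L) (hitProcess μ T A x) ∂μ =
      expNeg (μ A) ^ s * ((∫ x in A, laplaceMonomial L (hitProcess μ T A x) ∂μ) -
        ∫ x in A, laplaceMonomial (s :: L) (hitProcess μ T A x) ∂μ) := by
  set q := expNeg (μ A) ^ s
  set f := fun x => laplaceMonomial (s :: L) (hitProcess μ T A x)
  set g := fun x => laplaceMonomial L (hitProcess μ T A x)
  have hf : Integrable f μ := integrable_laplaceMonomial_hitProcess μ μ hT.measurable hA _
  have hg : Integrable g μ := integrable_laplaceMonomial_hitProcess μ μ hT.measurable hA _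
  -- The one-step recursions on T⁻¹A and its complement merge into f = q · (k ∘ T); integrating
  -- against the invariant measure removes T.
  set k := fun x => Aᶜ.indicator f x + A.indicator g x
  have hk : Integrable k μ := (hf.indicator hA.compl).add (hg.indicator hA)
  have hfk : ∀ x, f x = q * k (T x) := by
    intro x
    by_cases hx : T x ∈ A
    · simp only [k, indicator_of_mem hx, indicator_of_notMem (notMem_compl_iff.2 hx), zero_add]
      exact laplaceMonomial_hitProcess_of_mem s L hx
    · simp only [k, indicator_of_notMem hx, indicator_of_mem (mem_compl hx), add_zero]
      exact laplaceMonomial_hitProcess_of_notMem h0 L s hx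
  have h1 : ∫ x, f x ∂μ = q * ∫ x, k x ∂μ := by
    rw [integral_congr_ae (ae_of_all _ hfk), integral_const_mul]
    congr 1
    have := integral_map (μ := μ) hT.measurable.aemeasurable (f := k)
      (by rw [hT.map_eq]; exact hk.aestronglyMeasurable)
    rw [← this, hT.map_eq]
  have h2 : ∫ x, k x ∂μ = (∫ x, f x ∂μ) - (∫ x in A, f x ∂μ) + ∫ x in A, g x ∂μ := by
    rw [integral_add (hf.indicator hA.compl) (hg.indicator hA), integral_indicator hA.compl,
      integral_indicator hA, setIntegral_compl hA hf]
  linear_combination h1 + q * h2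

end Hitting

end

section

/-! ### Convergence in law through Laplace transforms -/

/-- Exponents add coordinatewise, the shorter list being padded by zeros. Hence monomials form a
multiplicative monoid, and the algebra they generate is just their linear span. -/
lemma exists_laplaceMonomial_eq_mul (L L' : List ℕ) :
    ∃ L'', ∀ h, laplaceMonomial L'' h = laplaceMonomial L h * laplaceMonomial L' h := by
  induction L generalizing L' with
  | nil => exact ⟨L', fun h => by simp [laplaceMonomial]⟩
  | cons s L ih =>
    rcases L' with _ | ⟨s', L'⟩
    · exact ⟨s :: L, fun h => by simp [laplaceMonomial]⟩
    · obtain ⟨M, hM⟩ := ih L'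
      refine ⟨(s + s') :: M, fun h => ?_⟩
      simp only [laplaceMonomial, hM, pow_add]
      ring

lemma exists_laplaceMonomial_eq_coord (i : ℕ) :
    ∃ L, ∀ h, laplaceMonomial L h = expNeg (h i) := by
  induction i with
  | zero => exact ⟨[1], fun h => by simp [laplaceMonomial]⟩
  | succ i ih =>
    obtain ⟨L, hL⟩ := ih
    exact ⟨0 :: L, fun h => by simp [laplaceMonomial, hL]⟩

/-- The monomials span a dense subspace of `C([0, ∞]^ℕ)`. -/
lemma exists_span_laplaceMonomial_near (χ : C(ℕ → ℝ≥0∞, ℝ)) {ε : ℝ} (hε : 0 < ε) :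
    ∃ g ∈ Submodule.span ℝ (range fun L : List ℕ =>
      (⟨laplaceMonomial L, continuous_laplaceMonomial L⟩ : C(ℕ → ℝ≥0∞, ℝ))),
      ‖χ - g‖ < ε := by
  set e : ℕ → C(ℕ → ℝ≥0∞, ℝ) :=
    fun i => ⟨fun h => expNeg (h i), continuous_expNeg.comp (continuous_apply i)⟩
  -- Stone–Weierstrass on the compact space [0,∞]^ℕ: the coordinate functions exp(-h_i) already
  -- separate points, including points with infinite coordinates.
  have hsep : (Algebra.adjoin ℝ (range e)).SeparatesPoints := by
    intro x y hxy
    obtain ⟨i, hi⟩ := Function.ne_iff.1 hxy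
    exact ⟨e i, ⟨e i, Algebra.subset_adjoin ⟨i, rfl⟩, rfl⟩, fun h => hi (expNeg_injective h)⟩
  have htop := ContinuousMap.subalgebra_topologicalClosure_eq_top_of_separatesPoints _ hsep
  have hχ : χ ∈ (Algebra.adjoin ℝ (range e)).topologicalClosure := htop ▸ Algebra.mem_top
  obtain ⟨g, hg, hgχ⟩ := Metric.mem_closure_iff.1 hχ ε hε
  refine ⟨g, ?_, by rwa [dist_eq_norm] at hgχ⟩
  have hg' : g ∈ Subalgebra.toSubmodule (Algebra.adjoin ℝ (range e)) := hg
  rw [Algebra.adjoin_eq_span] at hg'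
  refine Submodule.span_mono ?_ hg'
  intro f hf
  induction hf using Submonoid.closure_induction with
  | mem f hf =>
    obtain ⟨i, rfl⟩ := hf
    obtain ⟨L, hL⟩ := exists_laplaceMonomial_eq_coord i
    exact ⟨L, ContinuousMap.ext hL⟩
  | one => exact ⟨[], rfl⟩
  | mul f g _ _ ihf ihg =>
    obtain ⟨L, rfl⟩ := ihf
    obtain ⟨L', rfl⟩ := ihg
    obtain ⟨M, hM⟩ := exists_laplaceMonomial_eq_mul L L'
    exact ⟨M, ContinuousMap.ext hM⟩

lemma integrable_continuousMap {E : Type*} [TopologicalSpace E] [CompactSpace E]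
    [MeasurableSpace E] [OpensMeasurableSpace E] (P : Measure E) [IsFiniteMeasure P]
    (χ : C(E, ℝ)) : Integrable (fun e => χ e) P :=
  Integrable.of_bound χ.continuous.measurable.aestronglyMeasurable ‖χ‖
    (ae_of_all _ χ.norm_coe_le_norm)

lemma abs_integral_sub_le_norm {E : Type*} [TopologicalSpace E] [CompactSpace E]
    [MeasurableSpace E] [OpensMeasurableSpace E] (P : Measure E) [IsProbabilityMeasure P]
    (χ g : C(E, ℝ)) : |(∫ e, χ e ∂P) - ∫ e, g e ∂P| ≤ ‖χ - g‖ := by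
  rw [← integral_sub (integrable_continuousMap P χ) (integrable_continuousMap P g)]
  simpa using norm_integral_le_of_norm_le_const (μ := P) (C := ‖χ - g‖)
    (ae_of_all _ (χ - g).norm_coe_le_norm)

/-- Convergence passes from monomials to their span by linearity, and from the span to all
continuous functions by a three-ε argument, because probability measures are contractive for the
uniform norm. -/
lemma tendsto_integral_of_laplaceMonomial (P : ℕ → Measure (ℕ → ℝ≥0∞)) (Q : Measure (ℕ → ℝ≥0∞))
    [IsProbabilityMeasure Q] (hP : ∀ᶠ l in atTop, IsProbabilityMeasure (P l))
    (h : ∀ L, Tendsto (fun l => ∫ x, laplaceMonomial L x ∂(P l)) atTop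
      (𝓝 (∫ x, laplaceMonomial L x ∂Q))) (χ : C(ℕ → ℝ≥0∞, ℝ)) :
    Tendsto (fun l => ∫ x, χ x ∂(P l)) atTop (𝓝 (∫ x, χ x ∂Q)) := by
  have hspan : ∀ g ∈ Submodule.span ℝ (range fun L : List ℕ =>
      (⟨laplaceMonomial L, continuous_laplaceMonomial L⟩ : C(ℕ → ℝ≥0∞, ℝ))),
      Tendsto (fun l => ∫ x, g x ∂(P l)) atTop (𝓝 (∫ x, g x ∂Q)) := by
    intro g hg
    induction hg using Submodule.span_induction with
    | mem g hg => obtain ⟨L, rfl⟩ := hg; exact h L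
    | zero => simp
    | add f g _ _ hf hg =>
      have := hf.add hg
      rw [← integral_add (integrable_continuousMap Q f) (integrable_continuousMap Q g)] at this
      refine this.congr' ?_
      filter_upwards [hP] with l hl
      exact (integral_add (integrable_continuousMap _ f) (integrable_continuousMap _ g)).symm
    | smul a g _ hg =>
      simpa [integral_const_mul] using hg.const_mul a
  rw [Metric.tendsto_atTop']
  intro ε hε
  obtain ⟨g, hg, hgχ⟩ := exists_span_laplaceMonomial_near χ (ε := ε / 3) (by positivity)
  have h1 : ∀ᶠ l in atTop, dist (∫ x, g x ∂(P l)) (∫ x, g x ∂Q) < ε / 3 :=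
    (hspan g hg).eventually (Metric.ball_mem_nhds _ (by positivity))
  obtain ⟨N, hN⟩ := eventually_atTop.1 (h1.and hP)
  refine ⟨N, fun l hl => ?_⟩
  obtain ⟨h1, h2⟩ := hN l hl.le
  have h3 := abs_integral_sub_le_norm (P l) χ g
  have h4 := abs_integral_sub_le_norm Q χ g
  rw [Real.dist_eq, abs_lt] at *
  rw [abs_le] at h3 h4
  constructor <;> linarith

/-! ### Laplace transforms of the limit laws -/

lemma laplaceMonomial_eq_prod (L : List ℕ) (h : ℕ → ℝ≥0∞) :
    laplaceMonomial L h = ∏ i ∈ Finset.range L.length, expNeg (h i) ^ L.getD i 0 := by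
  induction L generalizing h with
  | nil => simp [laplaceMonomial]
  | cons s L ih =>
    rw [laplaceMonomial, ih, List.length_cons, Finset.prod_range_succ']
    simp [mul_comm]

instance isProbabilityMeasure_iidLaw (Q : Measure ℝ≥0∞) [IsProbabilityMeasure Q] :
    IsProbabilityMeasure (iidLaw Q) := by
  unfold iidLaw; infer_instance

/-- Only finitely many coordinates enter, so the infinite product restricts to a finite one, where
independence factorizes the integral. -/
lemma integral_laplaceMonomial_iidLaw (Q : Measure ℝ≥0∞) [IsProbabilityMeasure Q] (L : List ℕ) :
    ∫ h, laplaceMonomial L h ∂(iidLaw Q) = (L.map fun s => ∫ t, expNeg t ^ s ∂Q).prod := by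
  have h1 : ∫ h, laplaceMonomial L h ∂(iidLaw Q) =
      ∏ i ∈ Finset.range L.length, ∫ t, expNeg t ^ L.getD i 0 ∂Q := by
    rw [← Finset.prod_coe_sort, ← integral_fintype_prod_eq_prod, iidLaw,
      ← integral_restrict_infinitePi (μ := fun _ : ℕ => Q)
        (s := Finset.range L.length)]
    · refine integral_congr_ae (ae_of_all _ fun h => ?_)
      simp only [laplaceMonomial_eq_prod, Finset.restrict]
      exact (Finset.prod_coe_sort (Finset.range L.length)
        fun i => expNeg (h i) ^ L.getD i 0).symm
    · refine Measurable.aestronglyMeasurable ?_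
      exact Finset.measurable_prod _ fun i _ =>
        (continuous_expNeg.measurable.comp (measurable_pi_apply i)).pow_const _
  rw [h1]
  clear h1
  induction L with
  | nil => simp
  | cons s L ih =>
    rw [List.length_cons, Finset.prod_range_succ', List.map_cons, List.prod_cons, ← ih, mul_comm]
    simp

lemma isProbabilityMeasure_expLaw {r : ℝ} (hr : 0 < r) : IsProbabilityMeasure (expLaw r) := by
  have := isProbabilityMeasure_expMeasure hr
  exact Measure.isProbabilityMeasure_map ENNReal.measurable_ofReal.aemeasurable

lemma isProbabilityMeasure_compoundExpLaw {θ : ℝ} (h0 : 0 < θ) (h1 : θ ≤ 1) :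
    IsProbabilityMeasure (compoundExpLaw θ) := by
  have := isProbabilityMeasure_expLaw h0
  constructor
  simp only [compoundExpLaw, Measure.add_apply, Measure.smul_apply, measure_univ, smul_eq_mul,
    mul_one]
  rw [← ENNReal.ofReal_add (by linarith) h0.le]
  simp

lemma integral_expNeg_pow_expLaw {r : ℝ} (hr : 0 < r) (s : ℕ) :
    ∫ t, expNeg t ^ s ∂(expLaw r) = r / (s + r) := by
  have hs : (0 : ℝ) < s + r := by positivity
  rw [expLaw, integral_map ENNReal.measurable_ofReal.aemeasurable (f := fun t => expNeg t ^ s)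
    (continuous_expNeg.measurable.pow_const s).aestronglyMeasurable, expMeasure, gammaMeasure,
    integral_withDensity_eq_integral_toReal_smul (f := gammaPDF 1 r)
      (measurable_exponentialPDFReal r).ennreal_ofReal (ae_of_all _ fun x => ENNReal.ofReal_lt_top)]
  have h1 : ∀ x : ℝ, (gammaPDF 1 r x).toReal • expNeg (ENNReal.ofReal x) ^ s =
      (Ici 0).indicator (fun x => r * Real.exp (-(s + r) * x)) x := by
    intro x
    change (exponentialPDF r x).toReal • _ = _
    by_cases hx : 0 ≤ x
    · rw [indicator_of_mem (mem_Ici.2 hx), exponentialPDF_of_nonneg hx, expNeg_ofReal hx,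
        ENNReal.toReal_ofReal (by positivity), ← Real.exp_nat_mul, smul_eq_mul, mul_assoc,
        ← Real.exp_add]
      ring_nf
    · rw [indicator_of_notMem (by simpa using hx), exponentialPDF_of_neg (not_le.1 hx)]
      simp
  rw [integral_congr_ae (ae_of_all _ h1), integral_indicator measurableSet_Ici,
    integral_Ici_eq_integral_Ioi, integral_const_mul, integral_exp_mul_Ioi (by linarith)]
  rw [mul_zero, Real.exp_zero, neg_div_neg_eq, mul_one_div]

lemma integral_expNeg_pow_compoundExpLaw {θ : ℝ} (h0 : 0 < θ) (h1 : θ ≤ 1) (s : ℕ) :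
    ∫ t, expNeg t ^ s ∂(compoundExpLaw θ) = (1 - θ) + θ * (θ / (s + θ)) := by
  have := isProbabilityMeasure_expLaw h0
  have hint : ∀ ν : Measure ℝ≥0∞, IsFiniteMeasure ν → Integrable (fun t => expNeg t ^ s) ν :=
    fun ν _ => integrable_continuousMap ν ⟨fun t => expNeg t ^ s, continuous_expNeg.pow s⟩
  rw [compoundExpLaw, integral_add_measure
    ((hint _ inferInstance).smul_measure ENNReal.ofReal_ne_top)
    ((hint _ inferInstance).smul_measure ENNReal.ofReal_ne_top),
    integral_smul_measure, integral_smul_measure, integral_dirac, integral_expNeg_pow_expLaw h0,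
    ENNReal.toReal_ofReal (by linarith), ENNReal.toReal_ofReal h0.le]
  simp [expNeg_zero]

/-! ### From the return-time to the hitting-time process and back -/

/-- The quotient equals (e^{sa} - 1)/a, the slope at 0 of t ↦ e^{st}. It is the coefficient in the
hitting/return relation after division by q · μ(A). -/
lemma tendsto_one_sub_expNeg_pow_div {a : ℕ → ℝ≥0∞} (ha : Tendsto a atTop (𝓝 0))
    (ha0 : ∀ᶠ l in atTop, a l ≠ 0) (s : ℕ) :
    Tendsto (fun l => (1 - expNeg (a l) ^ s) / (expNeg (a l) ^ s * (a l).toReal)) atTop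
      (𝓝 s) := by
  have har : Tendsto (fun l => (a l).toReal) atTop (𝓝[≠] 0) := by
    refine tendsto_nhdsWithin_iff.2 ⟨(ENNReal.tendsto_toReal ENNReal.zero_ne_top).comp ha, ?_⟩
    filter_upwards [ha0, ha.eventually_lt_const ENNReal.zero_lt_top] with l h1 h2
    exact (ENNReal.toReal_pos h1 h2.ne).ne'
  have hd : HasDerivAt (fun t : ℝ => Real.exp (s * t)) (s : ℝ) 0 := by
    simpa using ((hasDerivAt_id (0 : ℝ)).const_mul (s : ℝ)).exp
  have hslope := hd.tendsto_slope.comp har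
  refine hslope.congr' ?_
  filter_upwards [ha0, ha.eventually_lt_const ENNReal.zero_lt_top] with l h1 h2
  have hpos := ENNReal.toReal_pos h1 h2.ne
  rw [expNeg_of_ne_top h2.ne, ← Real.exp_nat_mul]
  simp only [Function.comp_apply, slope_def_field, mul_zero, Real.exp_zero, sub_zero, mul_neg,
    Real.exp_neg]
  have := Real.exp_pos (s * (a l).toReal)
  field_simp

variable {X : Type*} [MeasurableSpace X] {μ : Measure X} [IsProbabilityMeasure μ] {T : X → X}

/-- If the return-time process is asymptotically a mixture, with weights `1 - θ` and `θ`, of a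
process returning immediately and of the hitting-time process, then its Laplace transforms converge
to those of the compound exponential law. -/
theorem tendsto_return_laplace (hT : MeasurePreserving T μ μ) {A : ℕ → Set X}
    (hA : ∀ᶠ l in atTop, MeasurableSet (A l)) (hA0 : ∀ᶠ l in atTop, μ (A l) ≠ 0)
    (hlim : Tendsto (fun l => μ (A l)) atTop (𝓝 0)) {θ : ℝ} (hθ : 0 < θ)
    (hmix : ∀ s L, Tendsto (fun l =>
      (μ.real (A l))⁻¹ * (∫ x in A l, laplaceMonomial (s :: L) (hitProcess μ T (A l) x) ∂μ) -
      (1 - θ) * ((μ.real (A l))⁻¹ * ∫ x in A l, laplaceMonomial L (hitProcess μ T (A l) x) ∂μ) -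
      θ * ∫ x, laplaceMonomial (s :: L) (hitProcess μ T (A l) x) ∂μ) atTop (𝓝 0)) (L : List ℕ) :
    Tendsto (fun l => (μ.real (A l))⁻¹ *
        ∫ x in A l, laplaceMonomial L (hitProcess μ T (A l) x) ∂μ) atTop
      (𝓝 (L.map fun s : ℕ => (1 - θ) + θ * (θ / (s + θ))).prod) := by
  induction L with
  | nil =>
    refine tendsto_const_nhds.congr' ?_
    filter_upwards [hA0] with l h0
    have : μ.real (A l) ≠ 0 := by simpa [measureReal_def, ENNReal.toReal_eq_zero_iff] using h0
    simp [laplaceMonomial, this]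
  | cons s L ih =>
    have hc := tendsto_one_sub_expNeg_pow_div hlim hA0 s
    set c := fun l => (1 - expNeg (μ (A l)) ^ s) / (expNeg (μ (A l)) ^ s * (μ (A l)).toReal)
    have hsθ : (0 : ℝ) < s + θ := by positivity
    -- Multiplying the mixture relation by c and replacing c·H(s :: L) by R(L) - R(s :: L) gives
    -- (c+θ) R(s :: L) = c·o(1) + (c(1-θ)+θ) R(L). Since θ > 0, division by c+θ is legitimate even
    -- for s = 0.
    have hnum := ((hc.mul (hmix s L)).add (((hc.mul_const (1 - θ)).add_const θ).mul ih)).div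
      (hc.add_const θ) hsθ.ne'
    have hev : ∀ᶠ l in atTop, c l + θ ≠ 0 := (hc.add_const θ).eventually_ne hsθ.ne'
    have hval : ((s : ℝ) * 0 + ((s : ℝ) * (1 - θ) + θ) *
        (L.map fun s : ℕ => (1 - θ) + θ * (θ / (s + θ))).prod) / (s + θ) =
        ((s :: L).map fun s : ℕ => (1 - θ) + θ * (θ / (s + θ))).prod := by
      rw [List.map_cons, List.prod_cons]
      field_simp
      ring
    rw [hval] at hnum
    refine hnum.congr' ?_
    filter_upwards [hev, hA, hA0] with l h1 h2 h3
    have hdual := laplace_hitting_return hT h2 h3 s L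
    have ha : 0 < (μ (A l)).toReal := ENNReal.toReal_pos h3 (measure_ne_top _ _)
    have hq : 0 < expNeg (μ (A l)) ^ s := by
      rw [expNeg_of_ne_top (measure_ne_top _ _)]; positivity
    have hdual2 : c l * ∫ x, laplaceMonomial (s :: L) (hitProcess μ T (A l) x) ∂μ =
        (μ.real (A l))⁻¹ * ((∫ x in A l, laplaceMonomial L (hitProcess μ T (A l) x) ∂μ) -
          ∫ x in A l, laplaceMonomial (s :: L) (hitProcess μ T (A l) x) ∂μ) := by
      simp only [c, measureReal_def]
      field_simp
      linear_combination hdual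
    rw [Pi.div_apply, div_eq_iff h1]
    linear_combination (-θ) * hdual2

end

section

/-! ### Asymptotically invariant functions -/

/-- The orthogonal complement of ker W is the closure of the range of W*, and ⟨f, W*y⟩ = ⟨Wf, y⟩ is
small when Wf is. Boundedness of the f_l handles the closure. -/
lemma tendsto_inner_of_mem_ker_orthogonal {H : Type*} [NormedAddCommGroup H]
    [InnerProductSpace ℝ H] [CompleteSpace H] (W : H →L[ℝ] H) (f : ℕ → H) {K : ℝ}
    (hf : ∀ l, ‖f l‖ ≤ K) (hW : Tendsto (fun l => ‖W (f l)‖) atTop (𝓝 0)) {g : H}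
    (hg : g ∈ W.kerᗮ) : Tendsto (fun l => inner ℝ (f l) g) atTop (𝓝 0) := by
  have hK : 0 ≤ K := (norm_nonneg _).trans (hf 0)
  rw [ContinuousLinearMap.orthogonal_ker] at hg
  rw [Metric.tendsto_atTop']
  intro ε hε
  obtain ⟨_, ⟨y, rfl⟩, hy⟩ := Metric.mem_closure_iff.1 hg (ε / (2 * (K + 1))) (by positivity)
  have h1 : Tendsto (fun l => ‖W (f l)‖ * ‖y‖) atTop (𝓝 0) := by simpa using hW.mul_const ‖y‖
  obtain ⟨N, hN⟩ := eventually_atTop.1 (h1.eventually_lt_const (half_pos hε))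
  refine ⟨N, fun l hl => ?_⟩
  have h2 := hN l hl.le
  set w : H := ContinuousLinearMap.adjoint W y
  have h3 : inner ℝ (f l) g = inner ℝ (f l) (g - w) + inner ℝ (W (f l)) y := by
    rw [← ContinuousLinearMap.adjoint_inner_right, ← inner_add_right, sub_add_cancel]
  have h4 : |inner ℝ (f l) (g - w)| ≤ K * (ε / (2 * (K + 1))) := by
    refine (abs_real_inner_le_norm _ _).trans (mul_le_mul (hf l) ?_ (norm_nonneg _) hK)
    rw [← dist_eq_norm]
    exact hy.le
  have h5 : |inner ℝ (W (f l)) y| ≤ ‖W (f l)‖ * ‖y‖ := abs_real_inner_le_norm _ _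
  have h6 : K * (ε / (2 * (K + 1))) ≤ ε / 2 := by
    rw [mul_div_assoc', div_le_div_iff₀ (by positivity) (by positivity)]
    nlinarith
  rw [dist_zero_right, Real.norm_eq_abs, h3]
  exact (abs_add_le _ _).trans_lt (by linarith)

section Ergodic

variable {X : Type*} [MeasurableSpace X] {μ : Measure X} [IsProbabilityMeasure μ] {T : X → X}

lemma memLp_of_mem_Icc {F : X → ℝ} (hF : Measurable F) (h : ∀ x, F x ∈ Icc (0 : ℝ) 1) :
    MemLp F 2 μ :=
  MemLp.of_bound hF.aestronglyMeasurable 1 (ae_of_all _ fun x => by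
    rw [Real.norm_of_nonneg (h x).1]; exact (h x).2)

lemma integrable_of_mem_Icc (ν : Measure X) [IsFiniteMeasure ν] {F : X → ℝ} (hF : Measurable F)
    (h : ∀ x, F x ∈ Icc (0 : ℝ) 1) : Integrable F ν :=
  Integrable.of_bound hF.aestronglyMeasurable 1 (ae_of_all _ fun x => by
    rw [Real.norm_of_nonneg (h x).1]; exact (h x).2)

omit [IsProbabilityMeasure μ] in
lemma inner_toLp_eq_integral {f g : X → ℝ} (hf : MemLp f 2 μ) (hg : MemLp g 2 μ) :
    inner ℝ (hf.toLp f) (hg.toLp g) = ∫ x, f x * g x ∂μ := by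
  rw [L2.inner_def]
  refine integral_congr_ae ?_
  filter_upwards [hf.coeFn_toLp, hg.coeFn_toLp] with x h1 h2
  rw [h1, h2]
  simp [mul_comm]

/-- For an ergodic map, asymptotically invariant functions are asymptotically uncorrelated with
every fixed event. -/
theorem tendsto_setIntegral_sub_of_asymptotically_invariant (hT : Ergodic T μ) (F : ℕ → X → ℝ)
    (hFm : ∀ l, Measurable (F l)) (hF : ∀ l x, F l x ∈ Icc (0 : ℝ) 1)
    (hinv : Tendsto (fun l => ∫ x, |F l x - F l (T x)| ∂μ) atTop (𝓝 0)) {C : Set X}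
    (hC : MeasurableSet C) :
    Tendsto (fun l => (∫ x in C, F l x ∂μ) - μ.real C * ∫ x, F l x ∂μ) atTop (𝓝 0) := by
  have hmp := hT.toMeasurePreserving
  set U : Lp ℝ 2 μ →L[ℝ] Lp ℝ 2 μ :=
    (Lp.compMeasurePreservingₗᵢ ℝ T hmp).toContinuousLinearMap with hU
  have hUto : ∀ {h : X → ℝ} (hh : MemLp h 2 μ),
      U (hh.toLp h) = (hh.comp_measurePreserving hmp).toLp _ := fun _ => rfl
  -- Ergodicity says that the kernel of I - U, with U the Koopman operator, consists of constants;
  -- hence centred indicators are orthogonal to it.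
  set W := ContinuousLinearMap.id ℝ (Lp ℝ 2 μ) - U with hWdef
  have hmem : ∀ l, MemLp (F l) 2 μ := fun l => memLp_of_mem_Icc (hFm l) (hF l)
  set g : X → ℝ := fun x => C.indicator 1 x - μ.real C
  have hgm : MemLp g 2 μ := by
    refine MemLp.sub ?_ (memLp_const _)
    exact memLp_of_mem_Icc (measurable_one.indicator hC) fun x => by
      by_cases hx : x ∈ C <;> simp [hx]
  have hg : hgm.toLp g ∈ W.kerᗮ := by
    rw [Submodule.mem_orthogonal]
    intro h hh
    have hh1 : U h = h := by
      have : h - U h = 0 := hh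
      exact (sub_eq_zero.1 this).symm
    have hh2 : h ∘ T =ᵐ[μ] h := by
      have h3 : (U h : X → ℝ) =ᵐ[μ] h ∘ T := Lp.coeFn_compMeasurePreserving h hmp
      rw [hh1] at h3
      exact h3.symm
    obtain ⟨c, hc⟩ := hT.quasiErgodic.ae_eq_const_of_ae_eq_comp_ae (Lp.aestronglyMeasurable h) hh2
    rw [L2.inner_def]
    have : ∀ᵐ x ∂μ, inner ℝ (h x) (hgm.toLp g x) = c * g x := by
      filter_upwards [hc, hgm.coeFn_toLp] with x h1 h2
      rw [h1, h2]
      simp [mul_comm]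
    rw [integral_congr_ae this, integral_const_mul, integral_sub, integral_indicator hC]
    · simp
    · exact (integrable_const _).indicator hC
    · exact integrable_const _
  have hWn : Tendsto (fun l => ‖W ((hmem l).toLp (F l))‖) atTop (𝓝 0) := by
    -- The hypothesis is an L¹ statement; since |F - F ∘ T| ≤ 1, its square is dominated by its
    -- absolute value, which gives the L² statement.
    have hsq : Tendsto (fun l => ‖W ((hmem l).toLp (F l))‖ ^ 2) atTop (𝓝 0) := by
      refine tendsto_of_tendsto_of_tendsto_of_le_of_le tendsto_const_nhds hinv
        (fun l => sq_nonneg _) fun l => ?_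
      have hd : MemLp (fun x => F l x - F l (T x)) 2 μ :=
        (hmem l).sub ((hmem l).comp_measurePreserving hmp)
      have h1 : W ((hmem l).toLp (F l)) = hd.toLp _ := by
        change (hmem l).toLp (F l) - U ((hmem l).toLp (F l)) = _
        rw [hUto, ← MemLp.toLp_sub]
        rfl
      rw [h1]
      dsimp only
      rw [← real_inner_self_eq_norm_sq, inner_toLp_eq_integral]
      refine integral_mono_of_nonneg (ae_of_all _ fun x => mul_self_nonneg _)
        ((hd.integrable one_le_two).abs) (ae_of_all _ fun x => ?_)
      have h2 : |F l x - F l (T x)| ≤ 1 := by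
        have := hF l x
        have := hF l (T x)
        simp only [mem_Icc] at *
        rw [abs_le]
        constructor <;> linarith
      dsimp only
      rw [← abs_mul_abs_self]
      exact mul_le_of_le_one_left (abs_nonneg _) h2
    have := hsq.sqrt
    simpa using this
  have hbd : ∀ l, ‖(hmem l).toLp (F l)‖ ≤ 1 := by
    intro l
    rw [← sq_le_one_iff₀ (norm_nonneg _), ← real_inner_self_eq_norm_sq, inner_toLp_eq_integral]
    have h1 : ∫ x, F l x * F l x ∂μ ≤ ∫ x, (1 : ℝ) ∂μ :=
      integral_mono_of_nonneg (ae_of_all _ fun x => mul_self_nonneg _) (integrable_const _)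
        (ae_of_all _ fun x => mul_le_one₀ (hF l x).2 (hF l x).1 (hF l x).2)
    simpa using h1
  refine (tendsto_inner_of_mem_ker_orthogonal W _ hbd hWn hg).congr fun l => ?_
  rw [inner_toLp_eq_integral, ← integral_indicator hC]
  have hint := integrable_of_mem_Icc μ (hFm l) (hF l)
  have : ∀ x, F l x * g x = C.indicator (F l) x - μ.real C * F l x := by
    intro x
    by_cases hx : x ∈ C <;> simp [g, hx] <;> ring
  rw [integral_congr_ae (ae_of_all _ this), integral_sub (hint.indicator hC)
    (hint.const_mul _), integral_const_mul]

/-! ### Equidistribution of measures with slowly varying densities -/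

/-- Comparability of the normalized measures on all subsets of C transfers to integrals of
nonnegative functions by monotonicity in the measure. The hypothesis is cross-multiplied so that no
density of ν is needed and no division by μ(C) occurs. -/
lemma abs_setIntegral_sub_le_of_comparable {ν : Measure X} [IsFiniteMeasure ν] {C : Set X}
    (hC : MeasurableSet C) {ε : ℝ} (hε : 0 ≤ ε) (hac : μ C = 0 → ν C = 0)
    (h : ∀ B, MeasurableSet B → B ⊆ C → ν B * μ C ≤ ENNReal.ofReal (1 + ε) * (ν C * μ B) ∧
      ν C * μ B ≤ ENNReal.ofReal (1 + ε) * (ν B * μ C))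
    {F : X → ℝ} (hFm : Measurable F) (hF : ∀ x, F x ∈ Icc (0 : ℝ) 1) :
    |(∫ x in C, F x ∂ν) - ν.real C / μ.real C * ∫ x in C, F x ∂μ| ≤ ε * ν.real C := by
  rcases eq_or_ne (μ C) 0 with h0 | h0
  · have h1 := hac h0
    rw [Measure.restrict_eq_zero.2 h1, Measure.restrict_eq_zero.2 h0]
    simp [measureReal_def, h1]
  have hpos : 0 < μ.real C := ENNReal.toReal_pos h0 (measure_ne_top _ _)
  have hintμ := integrable_of_mem_Icc (μ.restrict C) hFm hF
  have hintν := integrable_of_mem_Icc (ν.restrict C) hFm hF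
  have hnn : ∀ m : Measure X, 0 ≤ᵐ[m] F := fun m => ae_of_all _ fun x => (hF x).1
  have hcomp : ∀ m₁ m₂ : Measure X, IsFiniteMeasure m₁ → IsFiniteMeasure m₂ →
      (∀ B, MeasurableSet B → B ⊆ C → m₁ B * m₂ C ≤ ENNReal.ofReal (1 + ε) * (m₁ C * m₂ B)) →
      m₂.real C * ∫ x in C, F x ∂m₁ ≤ (1 + ε) * (m₁.real C * ∫ x in C, F x ∂m₂) := by
    intro m₁ m₂ _ _ hm
    have hle : m₂ C • m₁.restrict C ≤ (ENNReal.ofReal (1 + ε) * m₁ C) • m₂.restrict C := by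
      refine Measure.le_iff.2 fun B hB => ?_
      simp only [Measure.smul_apply, Measure.restrict_apply hB, smul_eq_mul]
      have := hm (B ∩ C) (hB.inter hC) inter_subset_right
      rwa [mul_comm, mul_assoc]
    have := integral_mono_measure hle (hnn _)
      ((integrable_of_mem_Icc (m₂.restrict C) hFm hF).smul_measure
        (ENNReal.mul_ne_top ENNReal.ofReal_ne_top (measure_ne_top _ _)))
    rw [integral_smul_measure, integral_smul_measure, ENNReal.toReal_mul,
      ENNReal.toReal_ofReal (by linarith), smul_eq_mul, smul_eq_mul, mul_assoc] at this
    exact this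
  have h1 := hcomp ν μ inferInstance inferInstance fun B hB hBC => (h B hB hBC).1
  have h2 := hcomp μ ν inferInstance inferInstance fun B hB hBC => by
    have := (h B hB hBC).2
    rwa [mul_comm (ν C), mul_comm (ν B)] at this
  have hμle : ∫ x in C, F x ∂μ ≤ μ.real C := by
    have := integral_mono hintμ (integrable_const (1 : ℝ)) fun x => (hF x).2
    simpa using this
  have hνle : ∫ x in C, F x ∂ν ≤ ν.real C := by
    have := integral_mono hintν (integrable_const (1 : ℝ)) fun x => (hF x).2
    simpa using this
  have hνC : 0 ≤ ν.real C := measureReal_nonneg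
  rw [div_mul_eq_mul_div, abs_le]
  constructor
  · rw [neg_le_sub_iff_le_add', div_le_iff₀ hpos]
    have := mul_le_mul_of_nonneg_left hνle (mul_nonneg hε hpos.le)
    nlinarith
  · rw [sub_le_iff_le_add, ← sub_le_iff_le_add', le_div_iff₀ hpos]
    have := mul_le_mul_of_nonneg_left hμle (mul_nonneg hε hνC)
    nlinarith

lemma exists_finset_measure_compl_sUnion_lt {𝒞 : Set (Set X)} (hc : 𝒞.Countable)
    (hm : ∀ C ∈ 𝒞, MeasurableSet C) (hd : 𝒞.PairwiseDisjoint id) (hcov : μ (⋃₀ 𝒞)ᶜ = 0)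
    {ε : ℝ} (hε : 0 < ε) : ∃ s : Finset (Set X), ↑s ⊆ 𝒞 ∧ μ.real (⋃ C ∈ s, C)ᶜ < ε := by
  classical
  have : Countable 𝒞 := hc
  have hsum : HasSum (fun C : 𝒞 => μ C) 1 := by
    have h1 : ∑' C : 𝒞, μ C = 1 := by
      rw [← measure_sUnion hc hd hm]
      exact (prob_compl_eq_zero_iff (MeasurableSet.sUnion hc hm)).1 hcov
    exact h1 ▸ ENNReal.summable.hasSum
  obtain ⟨s, hs⟩ := (hsum.eventually_const_lt (u := 1 - ENNReal.ofReal ε)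
    (ENNReal.sub_lt_self ENNReal.one_ne_top one_ne_zero (by simpa using hε))).exists
  have hsub : (↑(s.map (Function.Embedding.subtype _)) : Set (Set X)) ⊆ 𝒞 := by
    intro C hC
    simp only [Finset.coe_map, Function.Embedding.subtype_apply, mem_image] at hC
    obtain ⟨D, _, rfl⟩ := hC
    exact D.2
  refine ⟨s.map (Function.Embedding.subtype _), hsub, ?_⟩
  have hU : MeasurableSet (⋃ C ∈ s.map (Function.Embedding.subtype _), C) :=
    Finset.measurableSet_biUnion _ fun C hC => hm C (hsub hC)
  have hsum2 : μ (⋃ C ∈ s.map (Function.Embedding.subtype _), C) = ∑ C ∈ s, μ C := by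
    rw [measure_biUnion_finset (f := fun C => C) (hd.subset hsub) fun C hC => hm C (hsub hC),
      Finset.sum_map]
    rfl
  rw [measureReal_def]
  refine ENNReal.toReal_lt_of_lt_ofReal ?_
  rw [prob_compl_eq_one_sub hU, hsum2]
  refine (ENNReal.sub_lt_iff_lt_left (hsum2 ▸ measure_ne_top _ _) (hsum2 ▸ prob_le_one)).2 ?_
  exact not_le.1 fun h => hs.not_ge (ENNReal.le_sub_of_add_le_right ENNReal.ofReal_ne_top h)

/-- If the measures `ν_l` have uniformly bounded densities which vary slowly, uniformly in `l`, on
the elements of fine partitions, then they cannot be distinguished asymptotically from multiples of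
`μ` by functions which are asymptotically uncorrelated with every fixed event. -/
theorem tendsto_integral_sub_of_slowly_varying (F : ℕ → X → ℝ)
    (hFm : ∀ l, Measurable (F l)) (hF : ∀ l x, F l x ∈ Icc (0 : ℝ) 1)
    (hunc : ∀ C, MeasurableSet C →
      Tendsto (fun l => (∫ x in C, F l x ∂μ) - μ.real C * ∫ x, F l x ∂μ) atTop (𝓝 0))
    (ν : ℕ → Measure X) [∀ l, IsFiniteMeasure (ν l)] {K : ℝ} (hK : 0 ≤ K)
    (hν : ∀ l, 1 ≤ l → ∀ B, MeasurableSet B → (ν l).real B ≤ K * μ.real B)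
    (hloc : ∀ ε : ℝ, 0 < ε → ∃ 𝒞 : Set (Set X), 𝒞.Countable ∧ (∀ C ∈ 𝒞, MeasurableSet C) ∧
      𝒞.PairwiseDisjoint id ∧ μ (⋃₀ 𝒞)ᶜ = 0 ∧ ∀ l, 1 ≤ l → ∀ C ∈ 𝒞, ∀ B, MeasurableSet B →
        B ⊆ C → ν l B * μ C ≤ ENNReal.ofReal (1 + ε) * (ν l C * μ B) ∧
          ν l C * μ B ≤ ENNReal.ofReal (1 + ε) * (ν l B * μ C)) :
    Tendsto (fun l => (∫ x, F l x ∂(ν l)) - (ν l).real univ * ∫ x, F l x ∂μ) atTop (𝓝 0) := by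
  rw [Metric.tendsto_atTop']
  intro η hη
  -- This leaves room for an error εK from density variation on finitely many cells and errors of
  -- order Kε from the uncovered set; the other η/2 is for the decorrelation on those cells.
  obtain ⟨ε, hε, hεη⟩ : ∃ ε : ℝ, 0 < ε ∧ 3 * K * ε < η / 2 := by
    refine ⟨η / (2 * (3 * K + 1)), by positivity, ?_⟩
    rw [mul_div_assoc', div_lt_div_iff₀ (by positivity) (by positivity)]
    nlinarith
  obtain ⟨𝒞, hc, hm, hd, hcov, hcmp⟩ := hloc ε hε
  obtain ⟨s, hs, hsε⟩ := exists_finset_measure_compl_sUnion_lt hc hm hd hcov hε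
  set o : ℕ → Set X → ℝ := fun l C => |(∫ x in C, F l x ∂μ) - μ.real C * ∫ x, F l x ∂μ|
  have ho : Tendsto (fun l => K * ∑ C ∈ s, o l C) atTop (𝓝 0) := by
    have h1 : Tendsto (fun l => ∑ C ∈ s, o l C) atTop (𝓝 (∑ C ∈ s, 0)) :=
      tendsto_finsetSum _ fun C hC => by simpa [o] using (hunc C (hm C (hs hC))).abs
    simpa using h1.const_mul K
  obtain ⟨N, hN⟩ := eventually_atTop.1 (ho.eventually_lt_const (half_pos hη))
  refine ⟨N, fun l hl => ?_⟩
  have hl1 : 1 ≤ l := by omega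
  have hoN := hN l hl.le
  set m := ∫ x, F l x ∂μ
  have hintν := integrable_of_mem_Icc (ν l) (hFm l) (hF l)
  have hm0 : 0 ≤ m := integral_nonneg fun x => (hF l x).1
  have hm1 : m ≤ 1 := by
    have := integral_mono (integrable_of_mem_Icc μ (hFm l) (hF l)) (integrable_const (1 : ℝ))
      fun x => (hF l x).2
    simpa using this
  set D := ⋃ C ∈ s, C
  have hD : MeasurableSet D := Finset.measurableSet_biUnion _ fun C hC => hm C (hs hC)
  have hνD : (ν l).real D = ∑ C ∈ s, (ν l).real C :=
    measureReal_biUnion_finset (f := fun C => C) (hd.subset hs) fun C hC => hm C (hs hC)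
  have hpiece : ∀ C ∈ s, |(∫ x in C, F l x ∂(ν l)) - (ν l).real C * m| ≤
      ε * (ν l).real C + K * o l C := by
    intro C hC
    have hCm := hm C (hs hC)
    have hνC := hν l hl1 C hCm
    have hac : μ C = 0 → ν l C = 0 := by
      intro h0
      have h1 : (ν l).real C ≤ 0 := by simpa [measureReal_def, h0] using hνC
      have h2 := le_antisymm h1 measureReal_nonneg
      exact (measureReal_eq_zero_iff (measure_ne_top _ _)).1 h2
    have h1 := abs_setIntegral_sub_le_of_comparable hCm hε.le hac (hcmp l hl1 C (hs hC))
      (hFm l) (hF l)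
    have h2 : |(ν l).real C / μ.real C * (∫ x in C, F l x ∂μ) - (ν l).real C * m| ≤
        K * o l C := by
      rcases eq_or_ne (μ C) 0 with h0 | h0
      · have h3 : (ν l).real C = 0 := by simp [measureReal_def, hac h0]
        simp only [h3, zero_div, zero_mul, sub_zero, abs_zero]
        positivity
      · have hpos : 0 < μ.real C := ENNReal.toReal_pos h0 (measure_ne_top _ _)
        have h3 : (ν l).real C / μ.real C * (∫ x in C, F l x ∂μ) - (ν l).real C * m =
            (ν l).real C / μ.real C * ((∫ x in C, F l x ∂μ) - μ.real C * m) := by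
          field_simp
        rw [h3, abs_mul, abs_of_nonneg (by positivity)]
        refine mul_le_mul_of_nonneg_right ?_ (abs_nonneg _)
        rwa [div_le_iff₀ hpos]
    have h4 := abs_sub_le (∫ x in C, F l x ∂(ν l))
      ((ν l).real C / μ.real C * (∫ x in C, F l x ∂μ)) ((ν l).real C * m)
    linarith
  have hνu : (ν l).real univ ≤ K := by simpa using hν l hl1 univ MeasurableSet.univ
  have hsumD : |(∫ x in D, F l x ∂(ν l)) - (ν l).real D * m| ≤ ε * K + K * ∑ C ∈ s, o l C := by
    rw [hνD, integral_biUnion_finset (s := fun C => C) s (fun C hC => hm C (hs hC)) (hd.subset hs)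
      fun C _ => hintν.integrableOn, Finset.sum_mul, ← Finset.sum_sub_distrib]
    refine (Finset.abs_sum_le_sum_abs _ _).trans ((Finset.sum_le_sum hpiece).trans ?_)
    rw [Finset.sum_add_distrib, ← Finset.mul_sum, ← Finset.mul_sum, ← hνD]
    have : (ν l).real D ≤ K := (measureReal_mono (subset_univ D)).trans hνu
    gcongr
  have hrest : (ν l).real Dᶜ ≤ K * ε := by
    refine (hν l hl1 _ hD.compl).trans ?_
    gcongr
  have hrest2 : ∫ x in Dᶜ, F l x ∂(ν l) ≤ (ν l).real Dᶜ := by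
    have := integral_mono (integrable_of_mem_Icc ((ν l).restrict Dᶜ) (hFm l) (hF l))
      (integrable_const (1 : ℝ)) fun x => (hF l x).2
    simpa using this
  have hrest3 : 0 ≤ ∫ x in Dᶜ, F l x ∂(ν l) := integral_nonneg fun x => (hF l x).1
  have hrest4 : 0 ≤ (ν l).real Dᶜ := measureReal_nonneg
  have hrest5 : (ν l).real Dᶜ * m ≤ (ν l).real Dᶜ := mul_le_of_le_one_right hrest4 hm1
  have hrest6 : 0 ≤ (ν l).real Dᶜ * m := mul_nonneg hrest4 hm0
  rw [dist_zero_right, Real.norm_eq_abs, ← integral_add_compl hD hintν,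
    ← measureReal_add_measureReal_compl hD, abs_lt]
  rw [abs_le] at hsumD
  constructor <;> nlinarith

end Ergodic

end

section

/-! ### Cylinders given by words -/

/-- The cylinder of rank `n` given by the first `n` letters of the infinite word `z`. -/
def wordCyl {X : Type*} (T : X → X) (z : ℕ → Set X) (n : ℕ) : Set X :=
  {x | ∀ i < n, T^[i] x ∈ z i}

section Word

variable {X : Type*} {T : X → X} {ξ : Set (Set X)} {z z' : ℕ → Set X} {m n : ℕ} {x y : X}

lemma wordCyl_zero : wordCyl T z 0 = univ := by
  ext x
  simp [wordCyl]

lemma wordCyl_one : wordCyl T z 1 = z 0 := by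
  ext x
  simp [wordCyl]

lemma wordCyl_antitone (T : X → X) (z : ℕ → Set X) : Antitone (wordCyl T z) :=
  fun _ _ hmn _ hx i hi => hx i (hi.trans_le hmn)

lemma wordCyl_add (T : X → X) (z : ℕ → Set X) (n m : ℕ) :
    wordCyl T z (n + m) = wordCyl T z n ∩ T^[n] ⁻¹' wordCyl T (fun i => z (n + i)) m := by
  ext x
  constructor
  · intro h
    refine ⟨fun i hi => h i (by omega), fun i hi => ?_⟩
    rw [← Function.iterate_add_apply, add_comm i n]
    exact h _ (by omega)
  · rintro ⟨h1, h2⟩ i hi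
    rcases lt_or_ge i n with h | h
    · exact h1 i h
    · obtain ⟨j, rfl⟩ := Nat.exists_eq_add_of_le h
      have := h2 j (by omega)
      rwa [← Function.iterate_add_apply, add_comm j n] at this

lemma wordCyl_succ (T : X → X) (z : ℕ → Set X) (n : ℕ) :
    wordCyl T z (n + 1) = z 0 ∩ T ⁻¹' wordCyl T (fun i => z (i + 1)) n := by
  rw [add_comm, wordCyl_add, wordCyl_one]
  simp [add_comm]

lemma wordCyl_eq_iInter (T : X → X) (z : ℕ → Set X) (n : ℕ) :
    wordCyl T z n = ⋂ i : Fin n, T^[(i : ℕ)] ⁻¹' z i := by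
  ext x
  simp only [wordCyl, mem_ofPred_eq, mem_iInter, mem_preimage]
  exact ⟨fun h i => h i i.2, fun h i hi => h ⟨i, hi⟩⟩

lemma wordCyl_mem_cylinders (hz : ∀ i, z i ∈ ξ) (n : ℕ) : wordCyl T z n ∈ cylinders T ξ n :=
  ⟨fun i => z i, fun i => hz i, wordCyl_eq_iInter T z n⟩

lemma wordCyl_congr (h : ∀ i < n, z i = z' i) : wordCyl T z n = wordCyl T z' n := by
  ext x
  exact ⟨fun hx i hi => h i hi ▸ hx i hi, fun hx i hi => h i hi ▸ hx i hi⟩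

lemma eq_of_mem_partition (hd : ξ.PairwiseDisjoint id) {Z Z' : Set X} (hZ : Z ∈ ξ) (hZ' : Z' ∈ ξ)
    (hx : x ∈ Z) (hx' : x ∈ Z') : Z = Z' := by
  by_contra hne
  exact disjoint_left.1 (hd hZ hZ' hne) hx hx'

lemma letter_eq_of_mem (hd : ξ.PairwiseDisjoint id) (hz : ∀ i, z i ∈ ξ) (hz' : ∀ i, z' i ∈ ξ)
    (hx : x ∈ wordCyl T z m) (hx' : x ∈ wordCyl T z' n) {i : ℕ} (him : i < m) (hin : i < n) :
    z i = z' i :=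
  eq_of_mem_partition hd (hz i) (hz' i) (hx i him) (hx' i hin)

lemma wordCyl_eq_of_mem (hd : ξ.PairwiseDisjoint id) (hz : ∀ i, z i ∈ ξ) (hz' : ∀ i, z' i ∈ ξ)
    (hx : x ∈ wordCyl T z n) (hx' : x ∈ wordCyl T z' n) : wordCyl T z n = wordCyl T z' n :=
  wordCyl_congr fun _ hi => letter_eq_of_mem hd hz hz' hx hx' hi hi

lemma countable_wordCyl (hc : ξ.Countable) (n : ℕ) :
    {C | ∃ z : ℕ → Set X, (∀ i, z i ∈ ξ) ∧ C = wordCyl T z n}.Countable := by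
  induction n with
  -- Induction on the rank is used because the infinite words themselves are uncountable; only their
  -- first n letters matter.
  | zero =>
    refine (countable_singleton univ).mono ?_
    rintro _ ⟨z, -, rfl⟩
    exact wordCyl_zero
  | succ n ih =>
    refine (hc.image2 ih fun Z C => Z ∩ T ⁻¹' C).mono ?_
    rintro _ ⟨z, hz, rfl⟩
    exact ⟨z 0, hz 0, _, ⟨fun i => z (i + 1), fun i => hz _, rfl⟩, (wordCyl_succ T z n).symm⟩

lemma measurableSet_wordCyl [MeasurableSpace X] (hT : Measurable T)
    (hz : ∀ i, MeasurableSet (z i)) (n : ℕ) : MeasurableSet (wordCyl T z n) := by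
  rw [wordCyl_eq_iInter]
  exact .iInter fun i => hT.iterate i (hz i)

/-- The image of a cylinder of a Markov partition is the image of the element given by its last
letter. -/
lemma iterate_image_wordCyl (hM : ∀ Z ∈ ξ, ∀ Z' ∈ ξ, (T '' Z ∩ Z').Nonempty → Z' ⊆ T '' Z)
    (hz : ∀ i, z i ∈ ξ) (hne : (wordCyl T z (n + 1)).Nonempty) :
    T^[n + 1] '' wordCyl T z (n + 1) = T '' z n := by
  refine Subset.antisymm ?_ ?_
  · rintro _ ⟨x, hx, rfl⟩
    rw [Function.iterate_succ_apply']
    exact ⟨_, hx n (by omega), rfl⟩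
  · induction n generalizing z with
    | zero => simp [wordCyl_one]
    | succ n ih =>
      rw [wordCyl_succ] at hne ⊢
      obtain ⟨x, hx0, hx⟩ := hne
      have h1 : z 1 ⊆ T '' z 0 := hM _ (hz 0) _ (hz 1)
        ⟨T x, ⟨x, hx0, rfl⟩, hx 0 (by omega)⟩
      intro y hy
      obtain ⟨u, hu, rfl⟩ := ih (z := fun i => z (i + 1)) (fun i => hz _) ⟨T x, hx⟩ hy
      obtain ⟨u', hu', rfl⟩ := h1 (hu 0 (by omega))
      exact ⟨u', ⟨hu', hu⟩, rfl⟩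

/-- Under the Markov condition, a cylinder meeting the image of a partition element is contained
in it. -/
lemma wordCyl_subset_image (hM : ∀ Z ∈ ξ, ∀ Z' ∈ ξ, (T '' Z ∩ Z').Nonempty → Z' ⊆ T '' Z)
    {Z : Set X} (hZ : Z ∈ ξ) (hz : ∀ i, z i ∈ ξ) (hn : 1 ≤ n) (hx : x ∈ wordCyl T z n)
    (hxZ : x ∈ T '' Z) : wordCyl T z n ⊆ T '' Z := fun _ hy =>
  hM Z hZ (z 0) (hz 0) ⟨x, hxZ, hx 0 hn⟩ (hy 0 hn)

end Word

/-! ### Geometric decay of cylinder diameters -/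

lemma summable_of_le_mul_shift {f : ℕ → ℝ} (hf : ∀ n, 0 ≤ f n) {k : ℕ} {q : ℝ}
    (hq : q < 1) (h : ∀ n, f (n + k) ≤ q * f n) : Summable f := by
  -- The partial sums satisfy S_n ≤ S_{k+n} ≤ S_k + q S_n, whence the bound S_k/(1-q).
  refine summable_of_sum_range_le (c := (∑ i ∈ Finset.range k, f i) / (1 - q)) hf fun n => ?_
  have h1 : ∑ i ∈ Finset.range n, f i ≤ ∑ i ∈ Finset.range (k + n), f i :=
    Finset.sum_le_sum_of_subset_of_nonneg (Finset.range_subset_range.2 (by omega))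
      fun i _ _ => hf i
  rw [Finset.sum_range_add] at h1
  have h2 : ∑ i ∈ Finset.range n, f (k + i) ≤ q * ∑ i ∈ Finset.range n, f i := by
    rw [Finset.mul_sum]
    exact Finset.sum_le_sum fun i _ => add_comm i k ▸ h i
  rw [le_div_iff₀ (by linarith)]
  linarith

variable {X : Type*} [MetricSpace X] {T : X → X} {ξ : Set (Set X)}

/-- The diameters of the cylinders of a uniformly expanding system decrease exponentially. -/
lemma exists_summable_diam_bound (hb : Bornology.IsBounded (univ : Set X))
    (hexp : ∃ N : ℕ, 1 ≤ N ∧ ∃ ρ : ℝ, 0 < ρ ∧ ρ < 1 ∧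
      ∀ Z ∈ cylinders T ξ N, ∀ x ∈ Z, ∀ y ∈ Z, dist x y ≤ ρ * dist (T^[N] x) (T^[N] y)) :
    ∃ δ : ℕ → ℝ, (∀ m, 0 ≤ δ m) ∧ Summable δ ∧ ∀ z : ℕ → Set X, (∀ i, z i ∈ ξ) →
      ∀ m, ∀ x ∈ wordCyl T z m, ∀ y ∈ wordCyl T z m, dist x y ≤ δ m := by
  obtain ⟨N, hN, ρ, hρ0, hρ1, h⟩ := hexp
  set D := Metric.diam (univ : Set X)
  have hD : 0 ≤ D := Metric.diam_nonneg
  have hstep : ∀ m, (m + N) / N = m / N + 1 := fun m => Nat.add_div_right m hN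
  -- Each complete block of N letters contributes a factor ρ; the remaining fewer than N letters
  -- only give the diameter of X. The division is integer division.
  refine ⟨fun m => D * ρ ^ (m / N), fun m => by positivity, ?_, ?_⟩
  · refine summable_of_le_mul_shift (k := N) (fun m => by positivity) hρ1 fun m => ?_
    rw [hstep, pow_succ]
    exact le_of_eq (by ring)
  · intro z hz m
    beta_reduce
    induction m using Nat.strong_induction_on generalizing z with
    | _ m ih =>
      intro x hx y hy
      rcases lt_or_ge m N with hm | hm
      · rw [Nat.div_eq_of_lt hm, pow_zero, mul_one]
        exact Metric.dist_le_diam_of_mem hb (mem_univ x) (mem_univ y)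
      · obtain ⟨k, rfl⟩ := Nat.exists_eq_add_of_le hm
        rw [wordCyl_add] at hx hy
        have h1 := h _ (wordCyl_mem_cylinders hz N) x hx.1 y hy.1
        have h2 := ih k (by omega) (fun i => z (N + i)) (fun i => hz _) _ hx.2 _ hy.2
        rw [add_comm N k, hstep, pow_succ]
        calc dist x y ≤ ρ * dist (T^[N] x) (T^[N] y) := h1
          _ ≤ ρ * (D * ρ ^ (k / N)) := by gcongr
          _ = _ := by ring

/-! ### Inverse branches and their derivatives -/

lemma exists_continuousOn_inverse {Z : Set X} (h : IsEmbedding (Z.domRestrict T)) :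
    ∃ v : X → X, ContinuousOn v (T '' Z) ∧ (∀ y ∈ T '' Z, v y ∈ Z ∧ T (v y) = y) ∧
      ∀ x ∈ Z, v (T x) = x := by
  classical
  rcases isEmpty_or_nonempty X with hX | hX
  · exact ⟨id, continuousOn_id, fun y => (hX.false y).elim, fun x => (hX.false x).elim⟩
  have hv : ∀ y ∈ T '' Z, Function.invFunOn T Z y ∈ Z ∧ T (Function.invFunOn T Z y) = y :=
    fun y hy => Function.invFunOn_pos hy
  refine ⟨Function.invFunOn T Z, ?_, hv, fun x hx => ?_⟩
  · rw [continuousOn_iff_continuous_domRestrict]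
    set g : T '' Z → Z := fun y => ⟨Function.invFunOn T Z y, (hv y y.2).1⟩
    have hg : Continuous g := by
      rw [h.continuous_iff]
      have : Z.domRestrict T ∘ g = Subtype.val := funext fun y => (hv y y.2).2
      rw [this]
      exact continuous_subtype_val
    exact continuous_subtype_val.comp hg
  · have h1 := hv (T x) ⟨x, hx, rfl⟩
    have h2 : Z.domRestrict T ⟨_, h1.1⟩ = Z.domRestrict T ⟨x, hx⟩ := h1.2
    exact congrArg Subtype.val (h.injective h2)

lemma continuousOn_of_abs_div_sub_one_le {S : Set X} {w : X → ℝ} {r : ℝ} (hw : ∀ x ∈ S, 0 < w x)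
    (h : ∀ x ∈ S, ∀ y ∈ S, |w x / w y - 1| ≤ r * dist x y) : ContinuousOn w S := by
  intro y hy
  have hlim : Tendsto (fun x => w y * (r * dist x y)) (𝓝[S] y) (𝓝 0) := by
    have : Continuous fun x => w y * (r * dist x y) := by fun_prop
    have h0 := this.tendsto y
    simp only [dist_self, mul_zero] at h0
    exact h0.mono_left nhdsWithin_le_nhds
  refine tendsto_iff_dist_tendsto_zero.2
    (squeeze_zero' (Eventually.of_forall fun _ => dist_nonneg) ?_ hlim)
  filter_upwards [self_mem_nhdsWithin] with x hx
  have hy0 := hw y hy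
  have h1 : w x - w y = w y * (w x / w y - 1) := by field_simp
  rw [Real.dist_eq, h1, abs_mul, abs_of_pos hy0]
  exact mul_le_mul_of_nonneg_left (h x hx y hy) hy0.le

variable [MeasurableSpace X] [BorelSpace X] {μ : Measure X}

/-- This measure form of the derivative allows changes of variables under the integral without
handling the inverse branch. -/
lemma IsInverseBranchDeriv.map_restrict_eq {X : Type*} [MeasurableSpace X] {μ : Measure X}
    {T : X → X} (hT : Measurable T) {n : ℕ} {C B : Set X} {w : X → ℝ}
    (hw : IsInverseBranchDeriv μ T n C w) (hB : MeasurableSet B) (hBsub : B ⊆ T^[n] '' C) :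
    (μ.restrict (C ∩ T^[n] ⁻¹' B)).map T^[n] =
      (μ.restrict B).withDensity fun y => ENNReal.ofReal (w y) := by
  ext E hE
  rw [Measure.map_apply (hT.iterate n) hE, Measure.restrict_apply (hT.iterate n hE),
    withDensity_apply _ hE, Measure.restrict_restrict hE, inter_comm E B,
    ← hw.2 (B ∩ E) (hB.inter hE) (inter_subset_left.trans hBsub), preimage_inter]
  congr 1
  ext x
  simp only [mem_inter_iff, mem_preimage]
  tauto

/-- The chain rule for derivatives of inverse branches. -/
lemma IsInverseBranchDeriv.comp (hT : Measurable T) {Z C : Set X} {n : ℕ} (hC : MeasurableSet C)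
    (hCZ : C ⊆ T '' Z) {w₀ w₁ : X → ℝ} {v : X → X} (h0 : IsInverseBranchDeriv μ T 1 Z w₀)
    (hw0 : ContinuousOn w₀ (T '' Z)) (h1 : IsInverseBranchDeriv μ T n C w₁)
    (hw1 : ContinuousOn w₁ (T^[n] '' C)) (hv : ContinuousOn v (T^[n] '' C))
    (hvr : ∀ y ∈ T^[n] '' C, v y ∈ C) (hvl : ∀ x ∈ C, v (T^[n] x) = x)
    (himg : T^[n + 1] '' (Z ∩ T ⁻¹' C) = T^[n] '' C) :
    IsInverseBranchDeriv μ T (n + 1) (Z ∩ T ⁻¹' C) (fun y => w₀ (v y) * w₁ y) := by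
  refine ⟨fun y hy => ?_, fun B hB hBsub => ?_⟩
  · rw [himg] at hy
    exact mul_pos (h0.1 _ (by simpa using hCZ (hvr y hy))) (h1.1 y hy)
  · rw [himg] at hBsub
    have hBn : MeasurableSet (C ∩ T^[n] ⁻¹' B) := hC.inter (hT.iterate n hB)
    have hmeas0 : AEMeasurable (fun y => ENNReal.ofReal (w₀ (v y))) (μ.restrict B) := by
      have : ContinuousOn (fun y => w₀ (v y)) B :=
        (hw0.comp hv fun y hy => hCZ (hvr y hy)).mono hBsub
      exact (this.aemeasurable hB).ennreal_ofReal
    have hmeas1 : AEMeasurable (fun y => ENNReal.ofReal (w₁ y)) (μ.restrict B) :=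
      ((hw1.mono hBsub).aemeasurable hB).ennreal_ofReal
    have hmap : (μ.restrict (C ∩ T^[n] ⁻¹' B)).map T^[n] =
        (μ.restrict B).withDensity fun y => ENNReal.ofReal (w₁ y) :=
      h1.map_restrict_eq hT hB hBsub
    have hset : Z ∩ T ⁻¹' C ∩ T^[n + 1] ⁻¹' B = Z ∩ T^[1] ⁻¹' (C ∩ T^[n] ⁻¹' B) := by
      ext x
      simp only [mem_inter_iff, mem_preimage, Function.iterate_one, Function.iterate_succ_apply]
      tauto
    rw [hset, h0.2 _ hBn (by
      rw [Function.iterate_one]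
      exact inter_subset_left.trans hCZ)]
    -- On C the point x is v(Tⁿx), so the integrand becomes a function of Tⁿx and the second branch
    -- can be pushed forward.
    have hint : ∫⁻ x in C ∩ T^[n] ⁻¹' B, ENNReal.ofReal (w₀ x) ∂μ =
        ∫⁻ x in C ∩ T^[n] ⁻¹' B, ENNReal.ofReal (w₀ (v (T^[n] x))) ∂μ :=
      setLIntegral_congr_fun hBn fun x hx => by rw [hvl x hx.1]
    rw [hint, ← lintegral_map' (f := fun y => ENNReal.ofReal (w₀ (v y)))
      (by rw [hmap]; exact hmeas0.mono_ac (withDensity_absolutelyContinuous _ _))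
      (hT.iterate n).aemeasurable, hmap,
      lintegral_withDensity_eq_lintegral_mul₀ hmeas1 hmeas0]
    refine setLIntegral_congr_fun hB fun y hy => ?_
    have hpos := h0.1 (v y) (by simpa using hCZ (hvr y (hBsub hy)))
    simp only [Pi.mul_apply]
    rw [ENNReal.ofReal_mul hpos.le, mul_comm]

/-- Inverse branches of cylinders are continuous, and their derivatives have continuous versions
of bounded distortion. -/
theorem exists_continuous_deriv (hT : Measurable T) (hP : IsPiecewiseInvertible μ T ξ)
    (hM : ∀ Z ∈ ξ, ∀ Z' ∈ ξ, (T '' Z ∩ Z').Nonempty → Z' ⊆ T '' Z) {r : ℝ} (hr : 0 < r)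
    (hreg : ∀ Z ∈ ξ, ∃ w : X → ℝ, IsInverseBranchDeriv μ T 1 Z w ∧
      ∀ x ∈ T '' Z, ∀ y ∈ T '' Z, |w x / w y - 1| ≤ r * dist x y)
    {δ : ℕ → ℝ} (hδ : ∀ z : ℕ → Set X, (∀ i, z i ∈ ξ) →
      ∀ m, ∀ x ∈ wordCyl T z m, ∀ y ∈ wordCyl T z m, dist x y ≤ δ m)
    (n : ℕ) (z : ℕ → Set X) (hz : ∀ i, z i ∈ ξ) (hne : (wordCyl T z (n + 1)).Nonempty) :
    ∃ (v : X → X) (w : X → ℝ), ContinuousOn v (T '' z n) ∧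
      (∀ y ∈ T '' z n, v y ∈ wordCyl T z (n + 1) ∧ T^[n + 1] (v y) = y) ∧
      (∀ x ∈ wordCyl T z (n + 1), v (T^[n + 1] x) = x) ∧
      IsInverseBranchDeriv μ T (n + 1) (wordCyl T z (n + 1)) w ∧ ContinuousOn w (T '' z n) ∧
      ∀ z' : ℕ → Set X, (∀ i, z' i ∈ ξ) → ∀ m, ∀ x ∈ wordCyl T z' m ∩ T '' z n,
        ∀ y ∈ wordCyl T z' m ∩ T '' z n,
          w x ≤ Real.exp (r * ∑ i ∈ Finset.range (n + 1), δ (m + i)) * w y := by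
  have hdist : ∀ {Z : Set X} {w : X → ℝ}, (∀ x ∈ T '' Z, 0 < w x) →
      (∀ x ∈ T '' Z, ∀ y ∈ T '' Z, |w x / w y - 1| ≤ r * dist x y) →
      ∀ x ∈ T '' Z, ∀ y ∈ T '' Z, ∀ d, dist x y ≤ d → w x ≤ Real.exp (r * d) * w y := by
    intro Z w hpos hw x hx y hy d hd
    have h1 := (abs_le.1 (hw x hx y hy)).2
    have h2 : w x / w y ≤ Real.exp (r * d) := by
      have h3 := Real.add_one_le_exp (r * d)
      have h4 := mul_le_mul_of_nonneg_left hd hr.le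
      linarith
    rwa [div_le_iff₀ (hpos y hy)] at h2
  induction n generalizing z with
  | zero =>
    obtain ⟨v, hv1, hv2, hv3⟩ := exists_continuousOn_inverse (hP.homeo _ (hz 0))
    obtain ⟨w, hw1, hw2⟩ := hreg _ (hz 0)
    have hpos : ∀ x ∈ T '' z 0, 0 < w x := fun x hx => hw1.1 x (by simpa using hx)
    refine ⟨v, w, hv1, ?_, ?_, ?_, continuousOn_of_abs_div_sub_one_le hpos hw2, ?_⟩
    · simpa [wordCyl_one] using hv2
    · simpa [wordCyl_one] using hv3
    · simpa [wordCyl_one] using hw1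
    · intro z' hz' m x hx y hy
      simpa using hdist hpos hw2 x hx.2 y hy.2 _ (hδ z' hz' m x hx.1 y hy.1)
  | succ n ih =>
    have hsucc := wordCyl_succ T z (n + 1)
    have himg := iterate_image_wordCyl hM hz hne
    obtain ⟨x₀, hx₀⟩ := hne
    have hx₀' := hx₀
    rw [hsucc] at hx₀'
    have hzs : ∀ i, (fun i => z (i + 1)) i ∈ ξ := fun i => hz _
    obtain ⟨v', w', hv1, hv2, hv3, hw1, hw2, hw3⟩ := ih (fun i => z (i + 1)) hzs ⟨T x₀, hx₀'.2⟩
    have himg' := iterate_image_wordCyl hM hzs ⟨T x₀, hx₀'.2⟩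
    obtain ⟨v, hu1, hu2, hu3⟩ := exists_continuousOn_inverse (hP.homeo _ (hz 0))
    obtain ⟨w, ht1, ht2⟩ := hreg _ (hz 0)
    have hpos : ∀ x ∈ T '' z 0, 0 < w x := fun x hx => ht1.1 x (by simpa using hx)
    have hcw := continuousOn_of_abs_div_sub_one_le hpos ht2
    have hsub : wordCyl T (fun i => z (i + 1)) (n + 1) ⊆ T '' z 0 :=
      wordCyl_subset_image hM (hz 0) hzs (by omega) hx₀'.2 ⟨x₀, hx₀'.1, rfl⟩
    refine ⟨v ∘ v', fun y => w (v' y) * w' y, hu1.comp hv1 fun y hy => hsub (hv2 y hy).1,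
      fun y hy => ?_, fun x hx => ?_, ?_, (hcw.comp hv1 fun y hy => hsub (hv2 y hy).1).mul hw2, ?_⟩
    · have h1 := hv2 y hy
      have h2 := hu2 _ (hsub h1.1)
      rw [hsucc]
      refine ⟨⟨h2.1, ?_⟩, ?_⟩
      · rw [mem_preimage, Function.comp_apply, h2.2]
        exact h1.1
      · rw [Function.iterate_succ_apply, Function.comp_apply, h2.2]
        exact h1.2
    · rw [hsucc] at hx
      rw [Function.iterate_succ_apply, Function.comp_apply, hv3 _ hx.2, hu3 x hx.1]
    · rw [hsucc]
      refine ht1.comp hT (measurableSet_wordCyl hT (fun i => (hP.isOpen _ (hzs i)).measurableSet) _)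
        hsub hcw hw1 ?_ ?_ ?_ hv3 ?_
      · rwa [himg']
      · rwa [himg']
      · rw [himg']
        exact fun y hy => (hv2 y hy).1
      · rw [himg', ← hsucc]
        exact himg
    · intro z' hz' m x hx y hy
      have h1 := hw3 z' hz' m x hx y hy
      -- The concatenated word: the inverse branch v' sends an m-cylinder into a cylinder of rank
      -- n+1+m, so the new factor w ∘ v' has distortion at most exp(r δ(n+1+m)). Accumulating these
      -- factors gives the sum in the exponent.
      set u : ℕ → Set X := fun i => if i < n + 1 then z (i + 1) else z' (i - (n + 1))
      have hu : ∀ i, u i ∈ ξ := fun i => by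
        by_cases h : i < n + 1
        · simp only [u, if_pos h]; exact hz _
        · simp only [u, if_neg h]; exact hz' _
      have hmem : ∀ y ∈ wordCyl T z' m ∩ T '' z (n + 1), v' y ∈ wordCyl T u (n + 1 + m) := by
        intro y hy
        have h2 := hv2 y hy.2
        rw [wordCyl_add]
        refine ⟨?_, ?_⟩
        · rw [wordCyl_congr (z' := fun i => z (i + 1)) fun i hi => by simp only [u, if_pos hi]]
          exact h2.1
        · rw [mem_preimage, h2.2]
          rw [wordCyl_congr (z' := z') fun i _ => by
            simp [u, show ¬ n + 1 + i ≤ n by omega]]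
          exact hy.1
      have h2 := hdist hpos ht2 (v' x) (hsub (hv2 x hx.2).1) (v' y) (hsub (hv2 y hy.2).1) _
        (hδ u hu _ _ (hmem x hx) _ (hmem y hy))
      rw [Finset.sum_range_succ, mul_add, Real.exp_add, add_comm m (n + 1)]
      have h3 : 0 < w (v' y) := hpos _ (hsub (hv2 y hy.2).1)
      have h4 : 0 ≤ w' x := (hw1.1 x (by rw [himg']; exact hx.2)).le
      calc w (v' x) * w' x ≤ (Real.exp (r * δ (n + 1 + m)) * w (v' y)) *
            (Real.exp (r * ∑ i ∈ Finset.range (n + 1), δ (m + i)) * w' y) :=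
            mul_le_mul h2 h1 h4 (by positivity)
        _ = _ := by ring

end

section

/-! ### Bounded distortion of Gibbs-Markov systems -/

/-- Integrate w(x) ≤ c w(y) over x ∈ B and y ∈ B'. Taking one of the two sets to be a reference set
gives both the density and the distortion estimates. -/
lemma IsInverseBranchDeriv.measure_mul_le {X : Type*} [MeasurableSpace X] {μ : Measure X}
    [IsFiniteMeasure μ] {T : X → X} {n : ℕ} {Z S : Set X} {w : X → ℝ}
    (hw : IsInverseBranchDeriv μ T n Z w) {c : ℝ} (hc : 0 ≤ c)
    (h : ∀ x ∈ S ∩ T^[n] '' Z, ∀ y ∈ S ∩ T^[n] '' Z, w x ≤ c * w y) {B B' : Set X}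
    (hB : MeasurableSet B) (hB' : MeasurableSet B') (hBS : B ⊆ S ∩ T^[n] '' Z)
    (hBS' : B' ⊆ S ∩ T^[n] '' Z) :
    μ (Z ∩ T^[n] ⁻¹' B) * μ B' ≤ ENNReal.ofReal c * (μ (Z ∩ T^[n] ⁻¹' B') * μ B) := by
  rw [hw.2 B hB (hBS.trans inter_subset_right), hw.2 B' hB' (hBS'.trans inter_subset_right)]
  have h1 : ∀ y ∈ B', ∫⁻ x in B, ENNReal.ofReal (w x) ∂μ ≤
      ENNReal.ofReal c * μ B * ENNReal.ofReal (w y) := by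
    intro y hy
    calc ∫⁻ x in B, ENNReal.ofReal (w x) ∂μ ≤ ∫⁻ _ in B, ENNReal.ofReal (c * w y) ∂μ :=
          setLIntegral_mono' hB fun x hx =>
            ENNReal.ofReal_le_ofReal (h x (hBS hx) y (hBS' hy))
      _ = ENNReal.ofReal c * μ B * ENNReal.ofReal (w y) := by
          rw [setLIntegral_const, ENNReal.ofReal_mul hc]
          ring
  calc (∫⁻ x in B, ENNReal.ofReal (w x) ∂μ) * μ B' =
        ∫⁻ _ in B', (∫⁻ x in B, ENNReal.ofReal (w x) ∂μ) ∂μ := by rw [setLIntegral_const]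
    _ ≤ ∫⁻ y in B', ENNReal.ofReal c * μ B * ENNReal.ofReal (w y) ∂μ := setLIntegral_mono' hB' h1
    _ = ENNReal.ofReal c * ((∫⁻ x in B', ENNReal.ofReal (w x) ∂μ) * μ B) := by
      rw [lintegral_const_mul' _ _
        (ENNReal.mul_ne_top ENNReal.ofReal_ne_top (measure_ne_top _ _))]
      ring

/-- The geometric properties of cylinders on which the limit theorems rely: small diameters
(bounded by `δ`), bounded distortion (controlled by `κ`) and bounded densities of the images of
normalized cylinders (controlled by `K`). -/
structure HasCylinderBounds {X : Type*} [MetricSpace X] [MeasurableSpace X] (μ : Measure X)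
    (T : X → X) (ξ : Set (Set X)) (δ κ : ℕ → ℝ) (K : ℝ) : Prop where
  diam_le : ∀ z : ℕ → Set X, (∀ i, z i ∈ ξ) → ∀ m, ∀ x ∈ wordCyl T z m, ∀ y ∈ wordCyl T z m,
    dist x y ≤ δ m
  tendsto_diam : Tendsto δ atTop (𝓝 0)
  tendsto_distortion : Tendsto κ atTop (𝓝 1)
  nonneg : 0 ≤ K
  deriv : ∀ z : ℕ → Set X, (∀ i, z i ∈ ξ) → ∀ n, 1 ≤ n → (wordCyl T z n).Nonempty →
    ∃ w : X → ℝ, IsInverseBranchDeriv μ T n (wordCyl T z n) w ∧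
      ContinuousOn w (T^[n] '' wordCyl T z n)
  measure_pos : ∀ z : ℕ → Set X, (∀ i, z i ∈ ξ) → ∀ n, 1 ≤ n → (wordCyl T z n).Nonempty →
    0 < μ (wordCyl T z n)
  density_le : ∀ z : ℕ → Set X, (∀ i, z i ∈ ξ) → ∀ n, 1 ≤ n → (wordCyl T z n).Nonempty →
    ∀ B, MeasurableSet B →
      μ.real (wordCyl T z n ∩ T^[n] ⁻¹' B) ≤ K * μ.real (wordCyl T z n) * μ.real B
  distortion : ∀ z : ℕ → Set X, (∀ i, z i ∈ ξ) → ∀ n, 1 ≤ n → (wordCyl T z n).Nonempty →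
    ∀ z' : ℕ → Set X, (∀ i, z' i ∈ ξ) → ∀ m, 1 ≤ m → ∀ B, MeasurableSet B → B ⊆ wordCyl T z' m →
      μ (wordCyl T z n ∩ T^[n] ⁻¹' B) * μ (wordCyl T z' m) ≤
        ENNReal.ofReal (κ m) * (μ (wordCyl T z n ∩ T^[n] ⁻¹' wordCyl T z' m) * μ B) ∧
      μ (wordCyl T z n ∩ T^[n] ⁻¹' wordCyl T z' m) * μ B ≤
        ENNReal.ofReal (κ m) * (μ (wordCyl T z n ∩ T^[n] ⁻¹' B) * μ (wordCyl T z' m))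

variable {X : Type*} [MetricSpace X] [MeasurableSpace X] [BorelSpace X] {μ : Measure X}
  {T : X → X} {ξ : Set (Set X)}

/-- Summable diameters make the distortion of all inverse branches uniformly bounded, and on small
cylinders close to 1. Big images then turn bounded relative distortion into an absolute density
bound. -/
theorem IsErgodicGibbsMarkov.exists_hasCylinderBounds (h : IsErgodicGibbsMarkov μ T ξ) :
    ∃ δ κ K, HasCylinderBounds μ T ξ δ κ K := by
  have := h.isProbability
  have hT : Measurable T := h.ergodic.toMeasurePreserving.measurable
  have hP := h.piecewiseInvertible
  have hM := h.markov
  obtain ⟨δ, hδ0, hδs, hδ⟩ := exists_summable_diam_bound h.bounded h.expanding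
  obtain ⟨r, hr, hreg⟩ := h.regular
  obtain ⟨b, hb, hbig⟩ := h.bigImage
  have hderiv := exists_continuous_deriv hT hP hM hr hreg hδ
  -- Replacing the finite distortion sums by the whole tail makes the constant independent of the
  -- rank of the branch; summability sends it to 1.
  set κ : ℕ → ℝ := fun m => Real.exp (r * ∑' i, δ (i + m))
  have hκ : Tendsto κ atTop (𝓝 1) := by
    have h1 := ((tendsto_sum_nat_add δ).const_mul r)
    rw [mul_zero] at h1
    simpa [κ, Function.comp_def] using (Real.continuous_exp.tendsto 0).comp h1
  have hsum : ∀ n m, ∑ i ∈ Finset.range n, δ (m + i) ≤ ∑' i, δ (i + m) := by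
    intro n m
    simp only [add_comm m]
    exact ((summable_nat_add_iff m).2 hδs).sum_le_tsum _ fun i _ => hδ0 _
  have hZm : ∀ z : ℕ → Set X, (∀ i, z i ∈ ξ) → ∀ n, MeasurableSet (wordCyl T z n) :=
    fun z hz => measurableSet_wordCyl hT fun i => (hP.isOpen _ (hz i)).measurableSet
  -- properties of the derivatives of inverse branches of cylinders
  have hw : ∀ z : ℕ → Set X, (∀ i, z i ∈ ξ) → ∀ n, 1 ≤ n → (wordCyl T z n).Nonempty →
      ∃ w : X → ℝ, IsInverseBranchDeriv μ T n (wordCyl T z n) w ∧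
        ContinuousOn w (T^[n] '' wordCyl T z n) ∧
        ∀ z' : ℕ → Set X, (∀ i, z' i ∈ ξ) → ∀ m,
          ∀ x ∈ wordCyl T z' m ∩ T^[n] '' wordCyl T z n,
          ∀ y ∈ wordCyl T z' m ∩ T^[n] '' wordCyl T z n, w x ≤ κ m * w y := by
    intro z hz n hn hne
    obtain ⟨k, rfl⟩ : ∃ k, n = k + 1 := ⟨n - 1, by omega⟩
    obtain ⟨v, w, -, -, -, h1, h2, h3⟩ := hderiv k z hz hne
    have himg := iterate_image_wordCyl hM hz hne
    refine ⟨w, h1, by rwa [himg], fun z' hz' m x hx y hy => ?_⟩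
    have hpos := h1.1 y hy.2
    rw [himg] at hx hy
    refine (h3 z' hz' m x hx y hy).trans ?_
    gcongr
    exact Real.exp_le_exp.2 (mul_le_mul_of_nonneg_left (hsum _ _) hr.le)
  -- the part of the image of a cylinder covered by the partition
  have hY : ∀ z : ℕ → Set X, (∀ i, z i ∈ ξ) → ∀ n, 1 ≤ n → (wordCyl T z n).Nonempty →
      ∃ Y, MeasurableSet Y ∧ Y ⊆ T^[n] '' wordCyl T z n ∧ b ≤ μ Y ∧
        μ (wordCyl T z n ∩ T^[n] ⁻¹' Yᶜ) = 0 := by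
    intro z hz n hn hne
    obtain ⟨k, rfl⟩ : ∃ k, n = k + 1 := ⟨n - 1, by omega⟩
    have himg := iterate_image_wordCyl hM hz hne
    -- By the Markov property Y fills the image up to a null set. Unlike the image itself, it is
    -- visibly open, hence measurable.
    set Y := ⋃₀ {Z' ∈ ξ | Z' ⊆ T '' z k}
    have hYo : MeasurableSet Y :=
      (isOpen_sUnion fun Z' hZ' => hP.isOpen Z' hZ'.1).measurableSet
    have hcov : T '' z k ⊆ Y ∪ (⋃₀ ξ)ᶜ := by
      intro y hy
      by_cases hyξ : y ∈ ⋃₀ ξ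
      · obtain ⟨Z', hZ', hyZ'⟩ := hyξ
        exact Or.inl ⟨Z', ⟨hZ', hM _ (hz k) Z' hZ' ⟨y, hy, hyZ'⟩⟩, hyZ'⟩
      · exact Or.inr hyξ
    refine ⟨Y, hYo, ?_, ?_, ?_⟩
    · rw [himg]
      exact sUnion_subset fun Z' hZ' => hZ'.2
    · calc b ≤ μ (T '' z k) := hbig _ (hz k)
        _ ≤ μ (Y ∪ (⋃₀ ξ)ᶜ) := measure_mono hcov
        _ ≤ μ Y + μ (⋃₀ ξ)ᶜ := measure_union_le _ _
        _ = μ Y := by rw [hP.cover, add_zero]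
    · have hnull : μ (T^[k + 1] ⁻¹' (⋃₀ ξ)ᶜ) = 0 :=
        (h.ergodic.toMeasurePreserving.iterate (k + 1)).quasiMeasurePreserving.preimage_null
          hP.cover
      refine measure_mono_null ?_ hnull
      rintro x ⟨hx, hxY⟩
      have h1 : T^[k + 1] x ∈ T '' z k := himg ▸ ⟨x, hx, rfl⟩
      exact (hcov h1).resolve_left hxY
  have hb1 : ∀ {Y : Set X}, b ≤ μ Y → b.toReal ≤ μ.real Y := fun hbY =>
    ENNReal.toReal_mono (measure_ne_top _ _) hbY
  -- The density bound compares B ∩ Y with Y inside the rank-zero cylinder, which is the whole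
  -- space; this costs κ 0, and μ(Y) ≥ b gives the denominator.
  refine ⟨δ, κ, κ 0 / b.toReal, hδ, hδs.tendsto_atTop_zero, hκ, by positivity, ?_, ?_, ?_, ?_⟩
  · intro z hz n hn hne
    obtain ⟨w, h1, h2, -⟩ := hw z hz n hn hne
    exact ⟨w, h1, h2⟩
  · intro z hz n hn hne
    obtain ⟨w, h1, h2, -⟩ := hw z hz n hn hne
    obtain ⟨Y, hYm, hYs, hYb, -⟩ := hY z hz n hn hne
    refine lt_of_lt_of_le ?_ (measure_mono (inter_subset_left (t := T^[n] ⁻¹' Y)))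
    rw [h1.2 Y hYm hYs, pos_iff_ne_zero]
    intro h0
    rw [lintegral_eq_zero_iff' ((h2.mono hYs).aemeasurable hYm).ennreal_ofReal] at h0
    have h3 : ∀ᵐ x ∂μ.restrict Y, False := by
      filter_upwards [h0, ae_restrict_mem hYm] with x hx hxY
      have := h1.1 x (hYs hxY)
      simp only [Pi.zero_apply, ENNReal.ofReal_eq_zero] at hx
      linarith
    have h4 : μ Y = 0 := by
      rw [← Measure.restrict_eq_zero, ← ae_eq_bot]
      exact Filter.eventually_false_iff_eq_bot.1 h3
    exact (hb.trans_le hYb).ne' h4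
  · intro z hz n hn hne B hB
    obtain ⟨w, h1, -, h3⟩ := hw z hz n hn hne
    obtain ⟨Y, hYm, hYs, hYb, hY0⟩ := hY z hz n hn hne
    have hbpos : 0 < b.toReal :=
      ENNReal.toReal_pos hb.ne' (hYb.trans_lt (measure_lt_top _ _)).ne
    have h4 := h1.measure_mul_le (S := wordCyl T z 0) (Real.exp_nonneg _) (h3 z hz 0)
      (hB.inter hYm) hYm (by rw [wordCyl_zero, univ_inter]; exact inter_subset_right.trans hYs)
      (by rw [wordCyl_zero, univ_inter]; exact hYs)
    have h5 := ENNReal.toReal_mono (by finiteness) h4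
    simp only [ENNReal.toReal_mul, ENNReal.toReal_ofReal (Real.exp_nonneg _)] at h5
    have h6 : μ.real (wordCyl T z n ∩ T^[n] ⁻¹' B) ≤
        μ.real (wordCyl T z n ∩ T^[n] ⁻¹' (B ∩ Y)) := by
      refine ENNReal.toReal_mono (measure_ne_top _ _) ?_
      calc μ (wordCyl T z n ∩ T^[n] ⁻¹' B) ≤ μ (wordCyl T z n ∩ T^[n] ⁻¹' (B ∩ Y) ∪
            wordCyl T z n ∩ T^[n] ⁻¹' Yᶜ) := by
            refine measure_mono ?_
            rintro x ⟨hx, hxB⟩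
            by_cases hxY : T^[n] x ∈ Y
            · exact Or.inl ⟨hx, hxB, hxY⟩
            · exact Or.inr ⟨hx, hxY⟩
        _ ≤ _ := measure_union_le _ _
        _ = _ := by rw [hY0, add_zero]
    have h7 : μ.real (wordCyl T z n ∩ T^[n] ⁻¹' Y) ≤ μ.real (wordCyl T z n) :=
      measureReal_mono inter_subset_left
    have h8 : μ.real (B ∩ Y) ≤ μ.real B := measureReal_mono inter_subset_left
    have h9 := hb1 hYb
    change μ.real _ * μ.real Y ≤ κ 0 * (μ.real _ * μ.real _) at h5
    rw [div_mul_eq_mul_div, div_mul_eq_mul_div, le_div_iff₀ hbpos]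
    calc μ.real (wordCyl T z n ∩ T^[n] ⁻¹' B) * b.toReal
        ≤ μ.real (wordCyl T z n ∩ T^[n] ⁻¹' (B ∩ Y)) * μ.real Y := by gcongr
      _ ≤ κ 0 * (μ.real (wordCyl T z n ∩ T^[n] ⁻¹' Y) * μ.real (B ∩ Y)) := h5
      _ ≤ κ 0 * (μ.real (wordCyl T z n) * μ.real B) := by gcongr
      _ = _ := by ring
  · intro z hz n hn hne z' hz' m hm B hB hBC
    obtain ⟨w, h1, -, h3⟩ := hw z hz n hn hne
    -- By the Markov property an m-cylinder, m ≥ 1, is contained in the image or disjoint from it;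
    -- in the second case all terms vanish.
    by_cases hdis : (wordCyl T z' m ∩ T^[n] '' wordCyl T z n).Nonempty
    · obtain ⟨y, hy1, hy2⟩ := hdis
      have hsub : wordCyl T z' m ⊆ T^[n] '' wordCyl T z n := by
        obtain ⟨k, rfl⟩ : ∃ k, n = k + 1 := ⟨n - 1, by omega⟩
        rw [iterate_image_wordCyl hM hz hne] at hy2 ⊢
        exact wordCyl_subset_image hM (hz k) hz' hm hy1 hy2
      have hC := hZm z' hz' m
      exact ⟨h1.measure_mul_le (Real.exp_nonneg _) (h3 z' hz' m) hB hC
          (subset_inter hBC (hBC.trans hsub)) (subset_inter le_rfl hsub),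
        h1.measure_mul_le (Real.exp_nonneg _) (h3 z' hz' m) hC hB
          (subset_inter le_rfl hsub) (subset_inter hBC (hBC.trans hsub))⟩
    · have hempty : ∀ S ⊆ wordCyl T z' m, wordCyl T z n ∩ T^[n] ⁻¹' S = ∅ := by
        intro S hS
        refine eq_empty_of_forall_notMem fun x hx => hdis ⟨T^[n] x, hS hx.2, x, hx.1, rfl⟩
      rw [hempty B hBC, hempty _ le_rfl]
      simp

end

section

/-! ### Measures of cylinders -/

/-- An ergodic probability with an atom is carried by the orbit of a periodic point. -/
lemma exists_finite_periodic_of_atom {X : Type*} [MeasurableSpace X] [MeasurableSingletonClass X]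
    {μ : Measure X} [IsProbabilityMeasure μ] {T : X → X} (hT : Ergodic T μ) {y : X}
    (hy : μ {y} ≠ 0) :
    ∃ O : Set X, O.Finite ∧ μ Oᶜ = 0 ∧ ∀ x ∈ O, x ∈ Function.periodicPts T ∧ μ {x} ≠ 0 := by
  have hmp := hT.toMeasurePreserving
  -- Masses cannot decrease along the orbit of an atom, so a probability measure allows only
  -- finitely many distinct orbit points. The orbit ends in a cycle, which is forward invariant and
  -- of positive measure, hence of full measure by ergodicity.
  have hmono : ∀ n, μ {y} ≤ μ {T^[n] y} := by
    intro n
    rw [← (hmp.iterate n).measure_preimage (measurableSet_singleton (T^[n] y)).nullMeasurableSet]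
    exact measure_mono (by simp)
  have hninj : ¬ Function.Injective fun n => T^[n] y := by
    intro hinj
    have hfin := Measure.finite_const_le_meas_of_disjoint_iUnion μ (pos_iff_ne_zero.2 hy)
      (As := fun n => {T^[n] y}) (fun n => measurableSet_singleton _)
      (fun i j hij => by simpa using fun h => hij (hinj h))
      (measure_ne_top _ _)
    simp only [hmono] at hfin
    exact infinite_univ hfin
  obtain ⟨i, j, hij, hne⟩ : ∃ i j, T^[i] y = T^[j] y ∧ i < j := by
    simp only [Function.Injective, not_forall] at hninj
    obtain ⟨i, j, h1, h2⟩ := hninj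
    rcases lt_or_gt_of_ne h2 with h | h
    · exact ⟨i, j, h1, h⟩
    · exact ⟨j, i, h1.symm, h⟩
  obtain ⟨k, rfl⟩ := Nat.exists_eq_add_of_lt hne
  have hper : Function.IsPeriodicPt T (k + 1) (T^[i] y) := by
    change T^[k + 1] (T^[i] y) = T^[i] y
    rw [← Function.iterate_add_apply, hij, show k + 1 + i = i + k + 1 by omega]
  set O : Set X := (fun n => T^[n] (T^[i] y)) '' Iio (k + 1)
  have hOfin : O.Finite := (finite_Iio _).image _
  have hO : ∀ n, T^[n] (T^[i] y) ∈ O := fun n =>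
    ⟨n % (k + 1), Nat.mod_lt _ (by omega), hper.iterate_mod_apply n⟩
  have hsub : O ⊆ T ⁻¹' O := by
    rintro _ ⟨n, -, rfl⟩
    rw [mem_preimage, ← Function.iterate_succ_apply' T]
    exact hO _
  refine ⟨O, hOfin, ?_, ?_⟩
  · rcases hT.ae_empty_or_univ_of_ae_le_preimage' hOfin.measurableSet.nullMeasurableSet
      hsub.eventuallyLE (measure_ne_top _ _) with h | h
    · have h0 : μ O = 0 := by rw [measure_congr h, measure_empty]
      have h1 : μ {T^[i] y} = 0 := measure_mono_null (singleton_subset_iff.2 (hO 0)) h0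
      exact absurd (le_antisymm ((hmono i).trans h1.le) zero_le) hy
    · rw [prob_compl_eq_zero_iff hOfin.measurableSet, measure_congr h, measure_univ]
  · rintro _ ⟨n, -, rfl⟩
    refine ⟨⟨k + 1, by omega, hper.apply_iterate n⟩, ?_⟩
    dsimp only
    rw [← Function.iterate_add_apply]
    exact (lt_of_lt_of_le (pos_iff_ne_zero.2 hy) (hmono _)).ne'

section

variable {X : Type*} [MetricSpace X] [MeasurableSpace X] [BorelSpace X] {μ : Measure X}
  {T : X → X} {ξ : Set (Set X)} {δ κ : ℕ → ℝ} {K : ℝ}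

omit [BorelSpace X] in
lemma HasCylinderBounds.eq_of_mem (h : HasCylinderBounds μ T ξ δ κ K) {z : ℕ → Set X}
    (hz : ∀ i, z i ∈ ξ) {x y : X} (hx : ∀ n, x ∈ wordCyl T z n) (hy : ∀ n, y ∈ wordCyl T z n) :
    x = y := by
  refine dist_le_zero.1 (ge_of_tendsto' h.tendsto_diam fun n => ?_)
  exact h.diam_le z hz n x (hx n) y (hy n)

/-- If a point whose orbit stays in the partition is not periodic, or is not an atom, then there
are no atoms. -/
lemma HasCylinderBounds.measure_singleton [IsProbabilityMeasure μ]
    (h : HasCylinderBounds μ T ξ δ κ K)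
    (hT : Ergodic T μ) {z : ℕ → Set X} (hz : ∀ i, z i ∈ ξ) {x : X} (hx : ∀ n, x ∈ wordCyl T z n)
    (hxp : x ∉ Function.periodicPts T ∨ μ {x} = 0) (y : X) : μ {y} = 0 := by
  by_contra hy
  obtain ⟨O, hO, hO0, hOp⟩ := exists_finite_periodic_of_atom hT hy
  -- Otherwise small cylinders around x would avoid the finite set O carrying μ, although they have
  -- positive measure.
  have hxO : x ∈ O := by
    by_contra hxO
    have h1 : ∀ o ∈ O, ∀ᶠ n in atTop, o ∉ wordCyl T z n := by
      intro o ho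
      by_contra hfr
      have h2 : ∀ n, o ∈ wordCyl T z n := fun n => by
        obtain ⟨m, hm, hom⟩ := (frequently_atTop.1 hfr) n
        exact wordCyl_antitone T z hm hom
      exact hxO (h.eq_of_mem hz hx h2 ▸ ho)
    obtain ⟨n, hn, hn1⟩ :=
      (((Filter.eventually_all_finite hO).2 h1).and (eventually_ge_atTop 1)).exists
    have h3 : μ (wordCyl T z n) = 0 :=
      measure_mono_null (fun a ha haO => hn a haO ha) hO0
    exact (h.measure_pos z hz n hn1 ⟨x, hx n⟩).ne' h3
  rcases hxp with h1 | h1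
  · exact h1 (hOp x hxO).1
  · exact (hOp x hxO).2 h1

/-- In the absence of atoms, the measures of cylinders of rank `m` tend to zero uniformly. -/
lemma HasCylinderBounds.exists_measure_le [IsProbabilityMeasure μ]
    (h : HasCylinderBounds μ T ξ δ κ K) (hT : Measurable T) (hP : IsPiecewiseInvertible μ T ξ)
    (hat : ∀ x, μ {x} = 0) {ε : ℝ≥0∞} (hε : 0 < ε) :
    ∃ m₀, 1 ≤ m₀ ∧ ∀ m, m₀ ≤ m → ∀ z : ℕ → Set X, (∀ i, z i ∈ ξ) → μ (wordCyl T z m) ≤ ε := by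
  by_contra hcon
  push Not at hcon
  have hmeas : ∀ z : ℕ → Set X, (∀ i, z i ∈ ξ) → ∀ n, MeasurableSet (wordCyl T z n) :=
    fun z hz => measurableSet_wordCyl hT fun i => (hP.isOpen _ (hz i)).measurableSet
  -- The union of the m-cylinders heavier than ε. These sets decrease and have measure at least ε,
  -- so some point lies in all of them; its cylinders stay heavy while shrinking to a single point,
  -- which would be an atom.
  set U : ℕ → Set X := fun m =>
    ⋃₀ {C | ∃ z : ℕ → Set X, (∀ i, z i ∈ ξ) ∧ C = wordCyl T z m ∧ ε < μ C}
  have hUm : ∀ m, MeasurableSet (U m) := by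
    intro m
    refine MeasurableSet.sUnion ((countable_wordCyl (T := T) hP.countable m).mono ?_) ?_
    · rintro C ⟨z, hz, hC, -⟩
      exact ⟨z, hz, hC⟩
    · rintro C ⟨z, hz, rfl, -⟩
      exact hmeas z hz m
  have hUanti : Antitone U := by
    intro m n hmn x
    rintro ⟨C, ⟨z, hz, rfl, hC⟩, hx⟩
    exact ⟨_, ⟨z, hz, rfl, hC.trans_le (measure_mono (wordCyl_antitone T z hmn))⟩,
      wordCyl_antitone T z hmn hx⟩
  have hUε : ∀ m, ε ≤ μ (U m) := by
    intro m
    obtain ⟨n, hn, z, hz, hlt⟩ := hcon (max m 1) (le_max_right _ _)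
    have h1 : ε < μ (wordCyl T z m) :=
      hlt.trans_le (measure_mono (wordCyl_antitone T z ((le_max_left _ _).trans hn)))
    exact h1.le.trans (measure_mono (subset_sUnion_of_mem ⟨z, hz, rfl, h1⟩))
  have hlim := tendsto_measure_iInter_atTop (μ := μ) (fun m => (hUm m).nullMeasurableSet) hUanti
    ⟨0, measure_ne_top _ _⟩
  have hpos : 0 < μ (⋂ m, U m) := hε.trans_le (ge_of_tendsto' hlim hUε)
  obtain ⟨x, hx⟩ := nonempty_of_measure_ne_zero hpos.ne'
  rw [mem_iInter] at hx
  choose C hC hxC using hx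
  choose u hu hCu hCε using hC
  -- The words chosen at different ranks agree by disjointness of the partition, so a diagonal word
  -- describes all the cylinders around x.
  set z : ℕ → Set X := fun i => u (i + 1) i
  have hz : ∀ i, z i ∈ ξ := fun i => hu _ _
  have hxz : ∀ n, x ∈ wordCyl T z n := fun n i _ => by
    have h1 := hxC (i + 1)
    rw [hCu] at h1
    exact h1 i (by omega)
  have hzε : ∀ n, ε ≤ μ (wordCyl T z n) := fun n => by
    rw [wordCyl_eq_of_mem hP.disjoint hz (hu n) (hxz n) (hCu n ▸ hxC n), ← hCu n]
    exact (hCε n).le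
  have hlim2 := tendsto_measure_iInter_atTop (μ := μ)
    (fun m => (hmeas z hz m).nullMeasurableSet) (wordCyl_antitone T z) ⟨0, measure_ne_top _ _⟩
  have h2 : μ (⋂ n, wordCyl T z n) = 0 := by
    refine measure_mono_null (fun y hy => ?_) (hat x)
    rw [mem_iInter] at hy
    exact h.eq_of_mem hz hy hxz
  rw [h2] at hlim2
  exact hε.not_ge (ge_of_tendsto' hlim2 hzε)

/-- Exponential decay of the measures of nested cylinders. -/
lemma HasCylinderBounds.exists_measureReal_add_le [IsProbabilityMeasure μ]
    (h : HasCylinderBounds μ T ξ δ κ K) (hT : Measurable T) (hP : IsPiecewiseInvertible μ T ξ)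
    (hat : ∀ x, μ {x} = 0) {z : ℕ → Set X} (hz : ∀ i, z i ∈ ξ) {x : X}
    (hx : ∀ n, x ∈ wordCyl T z n) :
    ∃ m₀, 1 ≤ m₀ ∧ ∀ m, m₀ ≤ m → ∀ l, 1 ≤ l →
      μ.real (wordCyl T z (l + m)) ≤ 1 / 2 * μ.real (wordCyl T z l) := by
  have hK := h.nonneg
  obtain ⟨m₀, hm₀, hm⟩ := h.exists_measure_le hT hP hat
    -- Appending m letters multiplies the measure by at most K times the measure of an m-cylinder;
    -- the threshold makes this at most 1/2, and K + 1 also covers K = 0.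
    (ε := ENNReal.ofReal (1 / (2 * (K + 1)))) (ENNReal.ofReal_pos.2 (by positivity))
  refine ⟨m₀, hm₀, fun m hmm l hl => ?_⟩
  have hzs : ∀ i, (fun i => z (l + i)) i ∈ ξ := fun i => hz _
  have h1 := h.density_le z hz l hl ⟨x, hx l⟩ _
    (measurableSet_wordCyl hT (fun i => (hP.isOpen _ (hzs i)).measurableSet) m)
  rw [← wordCyl_add] at h1
  have h2 : μ.real (wordCyl T (fun i => z (l + i)) m) ≤ 1 / (2 * (K + 1)) :=
    ENNReal.toReal_le_of_le_ofReal (by positivity) (hm m hmm _ hzs)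
  have h3 : K * (1 / (2 * (K + 1))) ≤ 1 / 2 := by
    rw [mul_one_div, div_le_div_iff₀ (by positivity) (by positivity)]
    linarith
  calc μ.real (wordCyl T z (l + m)) ≤ K * μ.real (wordCyl T z l) * (1 / (2 * (K + 1))) :=
        h1.trans (by gcongr)
    _ = K * (1 / (2 * (K + 1))) * μ.real (wordCyl T z l) := by ring
    _ ≤ _ := by gcongr

/-! ### Summability of cylinder measures and rarity of short returns -/

lemma summable_and_tendsto_of_halving {f : ℕ → ℝ} (hf : ∀ n, 0 ≤ f n) {m : ℕ} (hm : 1 ≤ m)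
    (h : ∀ l, 1 ≤ l → f (l + m) ≤ 1 / 2 * f l) :
    Summable f ∧ Tendsto (fun l : ℕ => (l : ℝ) * f l) atTop (𝓝 0) := by
  constructor
  · rw [← summable_nat_add_iff 1]
    refine summable_of_le_mul_shift (fun n => hf _) (k := m) (q := 1 / 2) (by norm_num) fun n => ?_
    rw [add_right_comm]
    exact h _ (by omega)
  -- Starting at 2m ensures (n+3m)/2 ≤ (3/4)(n+2m), so halving over m steps still contracts l·f(l)
  -- by 3/4.
  · rw [← tendsto_add_atTop_iff_nat (2 * m)]
    refine Summable.tendsto_atTop_zero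
      (summable_of_le_mul_shift (fun n => mul_nonneg (Nat.cast_nonneg _) (hf _)) (k := m)
        (q := 3 / 4) (by norm_num) fun n => ?_)
    have h1 := h (n + 2 * m) (by omega)
    have h2 := hf (n + 2 * m)
    rw [add_right_comm]
    push_cast
    have h3 : (0 : ℝ) ≤ n + 2 * m + m := by positivity
    have h4 : (0 : ℝ) ≤ n := by positivity
    calc ((n : ℝ) + 2 * m + m) * f (n + 2 * m + m)
        ≤ (n + 2 * m + m) * (1 / 2 * f (n + 2 * m)) := by gcongr
      _ ≤ 3 / 4 * ((n + 2 * m) * f (n + 2 * m)) := by nlinarith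

/-- Short returns of the cylinders around a point are rare, apart from those on sets `B_l` which
contain all returns of any given order. -/
lemma HasCylinderBounds.tendsto_short_returns [IsProbabilityMeasure μ]
    (h : HasCylinderBounds μ T ξ δ κ K) (hT : Measurable T) (hP : IsPiecewiseInvertible μ T ξ)
    {z : ℕ → Set X} (hz : ∀ i, z i ∈ ξ) {x : X} (hx : ∀ n, x ∈ wordCyl T z n)
    (hsum : Summable fun l => μ.real (wordCyl T z l)) {D : ℕ → Set X}
    (hDA : ∀ l, D l ⊆ wordCyl T z l)
    (hD : ∀ j, 1 ≤ j → ∀ᶠ l in atTop, ∀ y ∈ D l, T^[j] y ∉ wordCyl T z l) :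
    Tendsto (fun l => (μ.real (wordCyl T z l))⁻¹ *
      μ.real {y ∈ D l | ∃ j, 1 ≤ j ∧ j ≤ l ∧ T^[j] y ∈ wordCyl T z l}) atTop (𝓝 0) := by
  have hK := h.nonneg
  have htail : Tendsto (fun J => K * ∑' i, μ.real (wordCyl T z (i + J))) atTop (𝓝 0) := by
    simpa using (tendsto_sum_nat_add fun l => μ.real (wordCyl T z l)).const_mul K
  rw [Metric.tendsto_atTop']
  intro η hη
  obtain ⟨J, hJ, hJ1⟩ :=
    ((htail.eventually_lt_const hη).and (eventually_ge_atTop 1)).exists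
  have hev : ∀ᶠ l in atTop, ∀ j ∈ Ico 1 J, ∀ y ∈ D l, T^[j] y ∉ wordCyl T z l :=
    (Filter.eventually_all_finite (finite_Ico 1 J)).2 fun j hj => hD j hj.1
  obtain ⟨N, hN⟩ := eventually_atTop.1 (hev.and (eventually_ge_atTop 1))
  refine ⟨N, fun l hl => ?_⟩
  obtain ⟨h1, hl1⟩ := hN l hl.le
  have hA : MeasurableSet (wordCyl T z l) :=
    measurableSet_wordCyl hT (fun i => (hP.isOpen _ (hz i)).measurableSet) l
  have hApos : 0 < μ.real (wordCyl T z l) :=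
    ENNReal.toReal_pos (h.measure_pos z hz l hl1 ⟨x, hx l⟩).ne' (measure_ne_top _ _)
  -- For J ≤ j ≤ l a return at time j puts y in A_j ∩ T^{-j}A_l, of measure at most K μ(A_j) μ(A_l).
  -- The sum over j is a tail of a convergent series.
  have hsub : {y ∈ D l | ∃ j, 1 ≤ j ∧ j ≤ l ∧ T^[j] y ∈ wordCyl T z l} ⊆
      ⋃ i ∈ Finset.range (l + 1),
        wordCyl T z (i + J) ∩ T^[i + J] ⁻¹' wordCyl T z l := by
    rintro y ⟨hyD, j, hj1, hjl, hjA⟩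
    have hJj : J ≤ j := by
      by_contra hlt
      exact h1 j ⟨hj1, not_le.1 hlt⟩ y hyD hjA
    obtain ⟨i, rfl⟩ := Nat.exists_eq_add_of_le' hJj
    simp only [mem_iUnion, Finset.mem_range]
    exact ⟨i, by omega, wordCyl_antitone T z hjl (hDA l hyD), hjA⟩
  have hle : μ.real {y ∈ D l | ∃ j, 1 ≤ j ∧ j ≤ l ∧ T^[j] y ∈ wordCyl T z l} ≤
      (K * ∑' i, μ.real (wordCyl T z (i + J))) * μ.real (wordCyl T z l) := by
    calc _ ≤ μ.real (⋃ i ∈ Finset.range (l + 1),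
          wordCyl T z (i + J) ∩ T^[i + J] ⁻¹' wordCyl T z l) :=
        measureReal_mono hsub (measure_ne_top _ _)
      _ ≤ ∑ i ∈ Finset.range (l + 1),
          μ.real (wordCyl T z (i + J) ∩ T^[i + J] ⁻¹' wordCyl T z l) :=
        measureReal_biUnion_finset_le _ _
      _ ≤ ∑ i ∈ Finset.range (l + 1), K * μ.real (wordCyl T z (i + J)) *
          μ.real (wordCyl T z l) :=
        Finset.sum_le_sum fun i _ => h.density_le z hz _ (by omega) ⟨x, hx _⟩ _ hA
      _ = (K * ∑ i ∈ Finset.range (l + 1), μ.real (wordCyl T z (i + J))) *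
          μ.real (wordCyl T z l) := by rw [← Finset.sum_mul, ← Finset.mul_sum]
      _ ≤ _ := by
        gcongr
        exact ((summable_nat_add_iff J).2 hsum).sum_le_tsum _ fun i _ => measureReal_nonneg
  rw [dist_zero_right, Real.norm_of_nonneg (by positivity), inv_mul_eq_div, div_lt_iff₀ hApos]
  exact hle.trans_lt (mul_lt_mul_of_pos_right hJ hApos)

omit [BorelSpace X] in
/-- Points of small cylinders do not return as long as the centre does not. -/
lemma HasCylinderBounds.eventually_notMem_of_iterate_ne
    (h : HasCylinderBounds μ T ξ δ κ K) {z : ℕ → Set X} (hz : ∀ i, z i ∈ ξ) {x : X}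
    (hx : ∀ n, x ∈ wordCyl T z n) {j : ℕ} (hj : T^[j] x ≠ x) :
    ∀ᶠ l in atTop, ∀ y ∈ wordCyl T z l, T^[j] y ∉ wordCyl T z l := by
  have hlim : Tendsto (fun l => δ l + δ (l + j)) atTop (𝓝 0) := by
    simpa using h.tendsto_diam.add (h.tendsto_diam.comp (tendsto_add_atTop_nat j))
  -- At rank l+j the points T^j y and T^j x still share an l-cylinder. A return of y would give
  -- d(T^j x, x) ≤ δ(l) + δ(l+j), which is eventually false.
  rw [← Filter.map_add_atTop_eq_nat j, eventually_map]
  filter_upwards [hlim.eventually_lt_const (dist_pos.2 hj)] with l hl y hy hyj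
  have hy2 := hy
  have hx2 := hx (j + l)
  rw [add_comm l j, wordCyl_add] at hy2
  rw [wordCyl_add] at hx2
  have h1 := h.diam_le (fun i => z (j + i)) (fun i => hz _) l _ hx2.2 _ hy2.2
  have h2 := h.diam_le z hz (l + j) _ hyj x (hx _)
  have h3 := dist_triangle (T^[j] x) (T^[j] y) x
  linarith

end

end

section

/-! ### Hitting-time and return-time processes of cylinders -/

lemma measure_compl_sUnion_wordCyl {X : Type*} [MeasurableSpace X] {μ : Measure X} {T : X → X}
    {ξ : Set (Set X)} (hT : MeasurePreserving T μ μ) (hcov : μ (⋃₀ ξ)ᶜ = 0) (m : ℕ) :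
    μ (⋃₀ {C | ∃ z : ℕ → Set X, (∀ i, z i ∈ ξ) ∧ C = wordCyl T z m})ᶜ = 0 := by
  have h0 : μ (⋃ i, T^[i] ⁻¹' (⋃₀ ξ)ᶜ) = 0 :=
    measure_iUnion_null fun i => (hT.iterate i).quasiMeasurePreserving.preimage_null hcov
  refine measure_mono_null (fun y hy => ?_) h0
  by_contra hcon
  simp only [mem_iUnion, mem_preimage, mem_compl_iff, not_exists, not_not] at hcon
  choose z hz hyz using hcon
  exact hy ⟨wordCyl T z m, ⟨z, hz, rfl⟩, fun i _ => hyz i⟩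

section Laplace

variable {X : Type*} [MeasurableSpace X] {μ : Measure X} [IsProbabilityMeasure μ] {T : X → X}

omit [IsProbabilityMeasure μ] in
lemma tendsto_expNeg_pow {A : ℕ → Set X} (hlim : Tendsto (fun l => μ (A l)) atTop (𝓝 0))
    (s : ℕ) : Tendsto (fun l => expNeg (μ (A l)) ^ s) atTop (𝓝 1) := by
  simpa [expNeg_zero] using ((continuous_expNeg.tendsto 0).comp hlim).pow s

/-- Laplace transforms of hitting-time processes of asymptotically rare events are asymptotically
invariant. -/
lemma tendsto_integral_laplaceMonomial_sub_comp (hT : MeasurePreserving T μ μ) {A : ℕ → Set X}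
    (hA : ∀ l, MeasurableSet (A l)) (hA0 : ∀ l, μ (A l) ≠ 0)
    (hlim : Tendsto (fun l => μ (A l)) atTop (𝓝 0)) (s : ℕ) (L : List ℕ) :
    Tendsto (fun l => ∫ x, |laplaceMonomial (s :: L) (hitProcess μ T (A l) x) -
      laplaceMonomial (s :: L) (hitProcess μ T (A l) (T x))| ∂μ) atTop (𝓝 0) := by
  have hbound : Tendsto (fun l => (1 - expNeg (μ (A l)) ^ s) + μ.real (A l)) atTop (𝓝 0) := by
    have h1 := ((tendsto_expNeg_pow hlim s).const_sub 1).add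
      ((ENNReal.tendsto_toReal ENNReal.zero_ne_top).comp hlim)
    simpa [measureReal_def, Function.comp_def] using h1
  refine squeeze_zero (fun l => integral_nonneg fun x => abs_nonneg _) (fun l => ?_) hbound
  set F := fun x => laplaceMonomial (s :: L) (hitProcess μ T (A l) x)
  have hF0 : ∀ x, 0 ≤ F x := fun x => laplaceMonomial_nonneg _ _
  have hF1 : ∀ x, F x ≤ 1 := fun x => laplaceMonomial_le_one _ _
  have hq0 : 0 ≤ expNeg (μ (A l)) ^ s := pow_nonneg (expNeg_nonneg _) _
  have hq1 : expNeg (μ (A l)) ^ s ≤ 1 := pow_le_one₀ (expNeg_nonneg _) (expNeg_le_one _)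
  have hTA : MeasurableSet (T ⁻¹' A l) := hT.measurable (hA l)
  have hpt : ∀ x, |F x - F (T x)| ≤
      (1 - expNeg (μ (A l)) ^ s) + (T ⁻¹' A l).indicator (fun _ => (1 : ℝ)) x := by
    intro x
    by_cases hx : T x ∈ A l
    · rw [indicator_of_mem (show x ∈ T ⁻¹' A l from hx), abs_le]
      have := hF0 x
      have := hF1 x
      have := hF0 (T x)
      have := hF1 (T x)
      constructor <;> linarith
    · rw [indicator_of_notMem (show x ∉ T ⁻¹' A l from hx), add_zero]
      have h1 : F x = expNeg (μ (A l)) ^ s * F (T x) :=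
        laplaceMonomial_hitProcess_of_notMem (hA0 l) L s hx
      rw [h1, show expNeg (μ (A l)) ^ s * F (T x) - F (T x) =
        -((1 - expNeg (μ (A l)) ^ s) * F (T x)) by ring, abs_neg,
        abs_of_nonneg (mul_nonneg (by linarith) (hF0 _))]
      exact mul_le_of_le_one_right (by linarith) (hF1 _)
  have hint : Integrable (fun x => (1 - expNeg (μ (A l)) ^ s) +
      (T ⁻¹' A l).indicator (fun _ => (1 : ℝ)) x) μ :=
    (integrable_const _).add ((integrable_const (1 : ℝ)).indicator hTA)
  refine (integral_mono_of_nonneg (ae_of_all _ fun x => abs_nonneg _) hint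
    (ae_of_all _ hpt)).trans (le_of_eq ?_)
  rw [integral_add (integrable_const _) ((integrable_const (1 : ℝ)).indicator hTA),
    integral_indicator hTA]
  simp [measureReal_def, hT.measure_preimage (hA l).nullMeasurableSet]

/-- Replacing the hitting-time process by the process started `n` steps later changes Laplace
transforms only if there is an early visit or if `n` is not negligible at the scale `1 / μ A`. -/
lemma abs_setIntegral_laplaceMonomial_sub_iterate_le (hT : MeasurePreserving T μ μ) {A D : Set X}
    (hA : MeasurableSet A) (hA0 : μ A ≠ 0) (hD : MeasurableSet D) (s : ℕ) (L : List ℕ) (n : ℕ) :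
    |(∫ x in D, laplaceMonomial (s :: L) (hitProcess μ T A x) ∂μ) -
      ∫ x in D, laplaceMonomial (s :: L) (hitProcess μ T A (T^[n] x)) ∂μ| ≤
    (1 - (expNeg (μ A) ^ s) ^ n) * μ.real D +
      μ.real {y ∈ D | ∃ j, 1 ≤ j ∧ j ≤ n ∧ T^[j] y ∈ A} := by
  set F := fun x => laplaceMonomial (s :: L) (hitProcess μ T A x)
  have hF0 : ∀ x, 0 ≤ F x := fun x => laplaceMonomial_nonneg _ _
  have hF1 : ∀ x, F x ≤ 1 := fun x => laplaceMonomial_le_one _ _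
  set q := (expNeg (μ A) ^ s) ^ n
  have hq1 : q ≤ 1 := pow_le_one₀ (pow_nonneg (expNeg_nonneg _) _)
    (pow_le_one₀ (expNeg_nonneg _) (expNeg_le_one _))
  set R := {y ∈ D | ∃ j, 1 ≤ j ∧ j ≤ n ∧ T^[j] y ∈ A}
  have hR : MeasurableSet R := by
    have : R = D ∩ ⋃ (j : ℕ) (_ : 1 ≤ j ∧ j ≤ n), T^[j] ⁻¹' A := by
      ext y
      simp [R, and_assoc]
    rw [this]
    exact hD.inter (.iUnion fun j => .iUnion fun _ => hT.measurable.iterate j hA)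
  have hFm : Measurable F := measurable_laplaceMonomial_hitProcess μ hT.measurable hA _
  have hint : ∀ ν : Measure X, IsFiniteMeasure ν → Integrable F ν := fun ν _ =>
    integrable_laplaceMonomial_hitProcess μ ν hT.measurable hA _
  have hint2 : Integrable (fun x => F (T^[n] x)) (μ.restrict D) :=
    integrable_of_mem_Icc _ (hFm.comp (hT.measurable.iterate n)) fun x => ⟨hF0 _, hF1 _⟩
  rw [← integral_sub (hint _ inferInstance) hint2]
  have hpt : ∀ x ∈ D, |F x - F (T^[n] x)| ≤ (1 - q) + R.indicator (fun _ => (1 : ℝ)) x := by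
    intro x hxD
    by_cases hx : x ∈ R
    · rw [indicator_of_mem hx, abs_le]
      have := hF0 x
      have := hF1 x
      have := hF0 (T^[n] x)
      have := hF1 (T^[n] x)
      constructor <;> linarith
    · rw [indicator_of_notMem hx, add_zero]
      have h1 : F x = q * F (T^[n] x) :=
        laplaceMonomial_hitProcess_iterate hA0 L s fun j h1 h2 hj => hx ⟨hxD, j, h1, h2, hj⟩
      rw [h1, show q * F (T^[n] x) - F (T^[n] x) = -((1 - q) * F (T^[n] x)) by ring, abs_neg,
        abs_of_nonneg (mul_nonneg (by linarith) (hF0 _))]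
      exact mul_le_of_le_one_right (by linarith) (hF1 _)
  have hint3 : Integrable (fun x => (1 - q) + R.indicator (fun _ => (1 : ℝ)) x) (μ.restrict D) :=
    (integrable_const _).add ((integrable_const (1 : ℝ)).indicator hR)
  refine (abs_integral_le_integral_abs).trans ((integral_mono_of_nonneg
    (ae_of_all _ fun x => abs_nonneg _) hint3 ?_).trans (le_of_eq ?_))
  · filter_upwards [ae_restrict_mem hD] with x hx using hpt x hx
  · rw [integral_add (integrable_const _) ((integrable_const (1 : ℝ)).indicator hR),
      integral_indicator hR]
    have hRD : R ∩ D = R := inter_eq_left.2 fun y hy => hy.1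
    simp [measureReal_def, Measure.restrict_apply hR, hRD, mul_comm]

end Laplace

variable {X : Type*} [MetricSpace X] [MeasurableSpace X] [BorelSpace X] {μ : Measure X}
  [IsProbabilityMeasure μ] {T : X → X} {ξ : Set (Set X)} {δ κ : ℕ → ℝ} {K : ℝ}

/-- The T^l-image of μ on A_l ∩ T^{-l}E_l, divided by μ(A_l), has density at most K. Because each
cylinder of rank at least p lies inside or outside E_l, this density varies on it by at most the
distortion factor. The normalization by μ(A_l) rather than by the subset keeps the limiting
proportion visible. -/
lemma HasCylinderBounds.tendsto_integral_of_asymptotically_invariant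
    (h : HasCylinderBounds μ T ξ δ κ K)
    (hT : Ergodic T μ) (hP : IsPiecewiseInvertible μ T ξ)
    {z : ℕ → Set X} (hz : ∀ i, z i ∈ ξ) {x : X} (hx : ∀ n, x ∈ wordCyl T z n)
    {E : ℕ → Set X} {p : ℕ}
    (hEp : ∀ l, ∀ z' : ℕ → Set X, (∀ i, z' i ∈ ξ) → ∀ m, p ≤ m →
      wordCyl T z' m ⊆ E l ∨ Disjoint (wordCyl T z' m) (E l))
    (F : ℕ → X → ℝ) (hFm : ∀ l, Measurable (F l)) (hF : ∀ l x, F l x ∈ Icc (0 : ℝ) 1)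
    (hinv : Tendsto (fun l => ∫ x, |F l x - F l (T x)| ∂μ) atTop (𝓝 0)) :
    Tendsto (fun l => (μ.real (wordCyl T z l))⁻¹ *
        (∫ y in wordCyl T z l ∩ T^[l] ⁻¹' E l, F l (T^[l] y) ∂μ) -
      (μ.real (wordCyl T z l))⁻¹ * μ.real (wordCyl T z l ∩ T^[l] ⁻¹' E l) * ∫ y, F l y ∂μ)
      atTop (𝓝 0) := by
  have hTm := hT.toMeasurePreserving.measurable
  have hmeas : ∀ z : ℕ → Set X, (∀ i, z i ∈ ξ) → ∀ n, MeasurableSet (wordCyl T z n) :=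
    fun z hz => measurableSet_wordCyl hTm fun i => (hP.isOpen _ (hz i)).measurableSet
  set A := wordCyl T z
  set c : ℕ → ℝ≥0∞ := fun l => ENNReal.ofReal (μ.real (A l))⁻¹
  set ν : ℕ → Measure X := fun l => c l • (μ.restrict (A l ∩ T^[l] ⁻¹' E l)).map T^[l] with hνdef
  have hν_apply : ∀ l B, MeasurableSet B → ν l B = c l * μ (A l ∩ T^[l] ⁻¹' (E l ∩ B)) := by
    intro l B hB
    rw [hνdef, Measure.smul_apply, Measure.map_apply (hTm.iterate l) hB,
      Measure.restrict_apply (hTm.iterate l hB), smul_eq_mul, inter_comm, preimage_inter,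
      inter_assoc]
  have hν_real : ∀ l B, MeasurableSet B →
      (ν l).real B = (μ.real (A l))⁻¹ * μ.real (A l ∩ T^[l] ⁻¹' (E l ∩ B)) := by
    intro l B hB
    rw [measureReal_def, hν_apply l B hB, ENNReal.toReal_mul, ENNReal.toReal_ofReal (by positivity)]
    rfl
  have hfin : ∀ l, IsFiniteMeasure (ν l) := fun l =>
    ⟨by rw [hν_apply l univ .univ]; exact ENNReal.mul_lt_top ENNReal.ofReal_lt_top
          (measure_lt_top _ _)⟩
  have hνK : ∀ l, 1 ≤ l → ∀ B, MeasurableSet B → (ν l).real B ≤ K * μ.real B := by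
    intro l hl B hB
    have hpos : 0 < μ.real (A l) :=
      ENNReal.toReal_pos (h.measure_pos z hz l hl ⟨x, hx l⟩).ne' (measure_ne_top _ _)
    rw [hν_real l B hB, inv_mul_eq_div, div_le_iff₀ hpos]
    refine (measureReal_mono ?_ (measure_ne_top _ _)).trans
      ((h.density_le z hz l hl ⟨x, hx l⟩ B hB).trans (le_of_eq (by ring)))
    exact inter_subset_inter_right _ (preimage_mono inter_subset_right)
  have key := tendsto_integral_sub_of_slowly_varying F hFm hF
    (fun C hC => tendsto_setIntegral_sub_of_asymptotically_invariant hT F hFm hF hinv hC)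
    ν h.nonneg hνK ?_
  · refine key.congr fun l => ?_
    rw [hν_real l univ .univ, inter_univ, hνdef, integral_smul_measure,
      integral_map (hTm.iterate l).aemeasurable (hFm l).aestronglyMeasurable,
      ENNReal.toReal_ofReal (by positivity), smul_eq_mul]
  · intro ε hε
    obtain ⟨m, hmκ, hmp⟩ := ((h.tendsto_distortion.eventually_lt_const
      (show (1 : ℝ) < 1 + ε by linarith)).and (eventually_ge_atTop (max p 1))).exists
    refine ⟨{C | ∃ z : ℕ → Set X, (∀ i, z i ∈ ξ) ∧ C = wordCyl T z m},
      countable_wordCyl hP.countable m, ?_, ?_,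
      measure_compl_sUnion_wordCyl hT.toMeasurePreserving hP.cover m, ?_⟩
    · rintro _ ⟨z', hz', rfl⟩
      exact hmeas z' hz' m
    · rintro _ ⟨z', hz', rfl⟩ _ ⟨z'', hz'', rfl⟩ hne
      exact disjoint_left.2 fun y hy hy' =>
        hne (wordCyl_eq_of_mem hP.disjoint hz' hz'' hy hy')
    · rintro l hl _ ⟨z', hz', rfl⟩ B hB hBC
      have hC := hmeas z' hz' m
      rw [hν_apply l B hB, hν_apply l _ hC]
      rcases hEp l z' hz' m ((le_max_left _ _).trans hmp) with hsub | hdis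
      · rw [inter_eq_right.2 hsub, inter_eq_right.2 (hBC.trans hsub)]
        have hd := h.distortion z hz l hl ⟨x, hx l⟩ z' hz' m ((le_max_right _ _).trans hmp) B hB hBC
        have hκ : ENNReal.ofReal (κ m) ≤ ENNReal.ofReal (1 + ε) :=
          ENNReal.ofReal_le_ofReal hmκ.le
        constructor
        · calc c l * μ (A l ∩ T^[l] ⁻¹' B) * μ (wordCyl T z' m)
              = c l * (μ (A l ∩ T^[l] ⁻¹' B) * μ (wordCyl T z' m)) := by ring
            _ ≤ c l * (ENNReal.ofReal (1 + ε) *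
                (μ (A l ∩ T^[l] ⁻¹' wordCyl T z' m) * μ B)) :=
              mul_le_mul_right (hd.1.trans (mul_le_mul_left hκ _)) _
            _ = _ := by ring
        · calc c l * μ (A l ∩ T^[l] ⁻¹' wordCyl T z' m) * μ B
              = c l * (μ (A l ∩ T^[l] ⁻¹' wordCyl T z' m) * μ B) := by ring
            _ ≤ c l * (ENNReal.ofReal (1 + ε) *
                (μ (A l ∩ T^[l] ⁻¹' B) * μ (wordCyl T z' m))) :=
              mul_le_mul_right (hd.2.trans (mul_le_mul_left hκ _)) _
            _ = _ := by ring
      · rw [hdis.symm.inter_eq, (hdis.symm.mono_right hBC).inter_eq]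
        simp

/-- Away from the part of `A_l` which returns too early, the return-time process is asymptotically
distributed like the hitting-time process. -/
theorem HasCylinderBounds.tendsto_setIntegral_laplaceMonomial
    (h : HasCylinderBounds μ T ξ δ κ K)
    (hT : Ergodic T μ) (hP : IsPiecewiseInvertible μ T ξ) (hat : ∀ y, μ {y} = 0)
    {z : ℕ → Set X} (hz : ∀ i, z i ∈ ξ) {x : X} (hx : ∀ n, x ∈ wordCyl T z n)
    {E : ℕ → Set X} (hE : ∀ l, MeasurableSet (E l)) {p : ℕ}
    (hEp : ∀ l, ∀ z' : ℕ → Set X, (∀ i, z' i ∈ ξ) → ∀ m, p ≤ m →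
      wordCyl T z' m ⊆ E l ∨ Disjoint (wordCyl T z' m) (E l))
    (hret : ∀ j, 1 ≤ j → ∀ᶠ l in atTop, ∀ y ∈ wordCyl T z l ∩ T^[l] ⁻¹' E l,
      T^[j] y ∉ wordCyl T z l) {θ : ℝ}
    (hθ : Tendsto (fun l => (μ.real (wordCyl T z l))⁻¹ *
      μ.real (wordCyl T z l ∩ T^[l] ⁻¹' E l)) atTop (𝓝 θ)) (s : ℕ) (L : List ℕ) :
    Tendsto (fun l => (μ.real (wordCyl T z l))⁻¹ *
        (∫ y in wordCyl T z l ∩ T^[l] ⁻¹' E l,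
          laplaceMonomial (s :: L) (hitProcess μ T (wordCyl T z l) y) ∂μ) -
      θ * ∫ y, laplaceMonomial (s :: L) (hitProcess μ T (wordCyl T z l) y) ∂μ)
      atTop (𝓝 0) := by
  have hmp := hT.toMeasurePreserving
  have hTm := hmp.measurable
  have hA : ∀ n, MeasurableSet (wordCyl T z n) :=
    measurableSet_wordCyl hTm fun i => (hP.isOpen _ (hz i)).measurableSet
  have hA0 : ∀ n, μ (wordCyl T z n) ≠ 0 := by
    intro n
    rcases Nat.eq_zero_or_pos n with rfl | hn
    · simp [wordCyl_zero]
    · exact (h.measure_pos z hz n hn ⟨x, hx n⟩).ne'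
  obtain ⟨m₀, hm₀, hdecay⟩ := h.exists_measureReal_add_le hTm hP hat hz hx
  obtain ⟨hsum, hlsmall⟩ := summable_and_tendsto_of_halving
    (f := fun l => μ.real (wordCyl T z l)) (fun l => measureReal_nonneg) hm₀ (hdecay m₀ le_rfl)
  have hlim : Tendsto (fun l => μ (wordCyl T z l)) atTop (𝓝 0) :=
    (ENNReal.tendsto_toReal_iff (fun l => measure_ne_top _ _) ENNReal.zero_ne_top).1
      hsum.tendsto_atTop_zero
  set A := wordCyl T z
  set D := fun l => A l ∩ T^[l] ⁻¹' E l
  have hD : ∀ l, MeasurableSet (D l) := fun l => (hA l).inter (hTm.iterate l (hE l))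
  set F : ℕ → X → ℝ := fun l y => laplaceMonomial (s :: L) (hitProcess μ T (A l) y)
  have hFm : ∀ l, Measurable (F l) := fun l =>
    measurable_laplaceMonomial_hitProcess μ hTm (hA l) _
  have hF : ∀ l y, F l y ∈ Icc (0 : ℝ) 1 := fun l y =>
    ⟨laplaceMonomial_nonneg _ _, laplaceMonomial_le_one _ _⟩
  have h1 := h.tendsto_integral_of_asymptotically_invariant hT hP hz hx hEp F hFm hF
    (tendsto_integral_laplaceMonomial_sub_comp hmp hA hA0 hlim s L)
  have hF01 : ∀ l, |∫ y, F l y ∂μ| ≤ 1 := by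
    intro l
    have := norm_integral_le_of_norm_le_const (μ := μ) (f := F l) (C := 1)
      (ae_of_all _ fun y => by rw [Real.norm_of_nonneg (hF l y).1]; exact (hF l y).2)
    simpa using this
  have h2 : Tendsto (fun l => ((μ.real (A l))⁻¹ * μ.real (D l) - θ) * ∫ y, F l y ∂μ) atTop
      (𝓝 0) := by
    have h3 : Tendsto (fun l => (μ.real (A l))⁻¹ * μ.real (D l) - θ) atTop (𝓝 0) := by
      simpa using hθ.sub_const θ
    refine squeeze_zero_norm (fun l => ?_) (by simpa using h3.norm)
    rw [norm_mul]
    exact mul_le_of_le_one_right (norm_nonneg _) (hF01 l)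
  -- A delay of l steps is negligible on the scale 1/μ(A_l), since l μ(A_l) → 0.
  have hq : Tendsto (fun l => 1 - (expNeg (μ (A l)) ^ s) ^ l) atTop (𝓝 0) := by
    have h3 : Tendsto (fun l : ℕ => Real.exp (-(s * (l * μ.real (A l))))) atTop (𝓝 1) := by
      have h4 := (Real.continuous_exp.tendsto 0).comp
        (by simpa using (hlsmall.const_mul (s : ℝ)).neg)
      simpa [Function.comp_def] using h4
    have h5 : ∀ l, (expNeg (μ (A l)) ^ s) ^ l = Real.exp (-(s * (l * μ.real (A l)))) := by
      intro l
      rw [expNeg_of_ne_top (measure_ne_top _ _), ← pow_mul, ← Real.exp_nat_mul]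
      push_cast
      rw [measureReal_def]
      ring_nf
    simp only [h5]
    simpa using h3.const_sub 1
  have hshort := h.tendsto_short_returns hTm hP hz hx hsum (D := D)
    (fun l => inter_subset_left) hret
  have h6 : Tendsto (fun l => (μ.real (A l))⁻¹ * ((∫ y in D l, F l y ∂μ) -
      ∫ y in D l, F l (T^[l] y) ∂μ)) atTop (𝓝 0) := by
    refine squeeze_zero_norm (fun l => ?_) (by simpa using hq.add hshort)
    have h7 := abs_setIntegral_laplaceMonomial_sub_iterate_le hmp (hA l) (hA0 l) (hD l) s L l
    have hApos : 0 < μ.real (A l) := ENNReal.toReal_pos (hA0 l) (measure_ne_top _ _)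
    have hq0 : 0 ≤ 1 - (expNeg (μ (A l)) ^ s) ^ l :=
      sub_nonneg.2 (pow_le_one₀ (pow_nonneg (expNeg_nonneg _) _)
        (pow_le_one₀ (expNeg_nonneg _) (expNeg_le_one _)))
    have h8 : (μ.real (A l))⁻¹ * μ.real (D l) ≤ 1 := by
      rw [inv_mul_eq_div, div_le_one hApos]
      exact measureReal_mono inter_subset_left
    rw [norm_mul, Real.norm_of_nonneg (by positivity), Real.norm_eq_abs]
    calc _ ≤ (μ.real (A l))⁻¹ * ((1 - (expNeg (μ (A l)) ^ s) ^ l) * μ.real (D l) +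
          μ.real {y ∈ D l | ∃ j, 1 ≤ j ∧ j ≤ l ∧ T^[j] y ∈ A l}) := by gcongr
      _ = (1 - (expNeg (μ (A l)) ^ s) ^ l) * ((μ.real (A l))⁻¹ * μ.real (D l)) +
          (μ.real (A l))⁻¹ * μ.real {y ∈ D l | ∃ j, 1 ≤ j ∧ j ≤ l ∧ T^[j] y ∈ A l} := by ring
      _ ≤ _ := by
        gcongr
        exact mul_le_of_le_one_right hq0 h8
  have h9 := (h6.add h1).add h2
  simp only [add_zero] at h9
  refine h9.congr fun l => ?_
  ring

end

section

/-! ### Poisson asymptotics at non-periodic points and compound laws at periodic points -/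

lemma convergesInLaw_hitProcess_of_laplace {X : Type*} [MeasurableSpace X] {μ : Measure X}
    {T : X → X} (hT : Measurable T) {A : ℕ → Set X} (hA : ∀ l, MeasurableSet (A l))
    (ν : ℕ → Measure X) [∀ l, IsProbabilityMeasure (ν l)] (Q : Measure ℝ≥0∞)
    [IsProbabilityMeasure Q]
    (h : ∀ L, Tendsto (fun l => ∫ x, laplaceMonomial L (hitProcess μ T (A l) x) ∂(ν l)) atTop
      (𝓝 (L.map fun s => ∫ t, expNeg t ^ s ∂Q).prod)) :
    ConvergesInLaw ν (fun l => hitProcess μ T (A l)) (iidLaw Q) := by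
  refine tendsto_integral_of_laplaceMonomial _ _ (Eventually.of_forall fun l =>
    Measure.isProbabilityMeasure_map (measurable_hitProcess μ hT (hA l)).aemeasurable) fun L => ?_
  rw [integral_laplaceMonomial_iidLaw]
  refine (h L).congr fun l => ?_
  rw [integral_map (measurable_hitProcess μ hT (hA l)).aemeasurable
    (continuous_laplaceMonomial L).measurable.aestronglyMeasurable]

lemma integral_cond_eq {X : Type*} [MeasurableSpace X] (μ : Measure X) (A : Set X) (f : X → ℝ) :
    ∫ x, f x ∂μ[|A] = (μ.real A)⁻¹ * ∫ x in A, f x ∂μ := by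
  rw [ProbabilityTheory.cond, integral_smul_measure, ENNReal.toReal_inv, smul_eq_mul, measureReal_def]

lemma ConvergesInLaw.congr' {X E : Type*} [MeasurableSpace X] [TopologicalSpace E]
    [MeasurableSpace E] {ν ν' : ℕ → Measure X} {R R' : ℕ → X → E} {Q : Measure E}
    (h : ConvergesInLaw ν R Q) (hν : ∀ᶠ l in atTop, ν l = ν' l)
    (hR : ∀ᶠ l in atTop, R l = R' l) : ConvergesInLaw ν' R' Q := by
  intro χ
  refine (h χ).congr' ?_
  filter_upwards [hν, hR] with l h1 h2
  rw [h1, h2]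

/-- Cylinders around a point are the cylinders of a single infinite word. -/
lemma exists_word_of_cylinders {X : Type*} {T : X → X} {ξ : Set (Set X)}
    (hd : ξ.PairwiseDisjoint id) {x : X} {A : ℕ → Set X}
    (hA : ∀ l : ℕ, 1 ≤ l → A l ∈ cylinders T ξ l ∧ x ∈ A l) :
    ∃ z : ℕ → Set X, (∀ i, z i ∈ ξ) ∧ (∀ n, x ∈ wordCyl T z n) ∧
      ∀ l, 1 ≤ l → A l = wordCyl T z l := by
  have h1 : ∀ i : ℕ, ∃ Z ∈ ξ, T^[i] x ∈ Z := by
    intro i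
    obtain ⟨⟨c, hc, hAc⟩, hx⟩ := hA (i + 1) (by omega)
    rw [hAc, mem_iInter] at hx
    exact ⟨c ⟨i, by omega⟩, hc _, hx ⟨i, by omega⟩⟩
  choose z hz hxz using h1
  refine ⟨z, hz, fun n i _ => hxz i, fun l hl => ?_⟩
  obtain ⟨⟨c, hc, hAc⟩, hx⟩ := hA l hl
  rw [hAc, mem_iInter] at hx
  rw [hAc, wordCyl_eq_iInter]
  refine iInter_congr fun i => ?_
  rw [eq_of_mem_partition hd (hc i) (hz i) (hx i) (hxz i)]

/-- If the derivative of an inverse branch is continuous at a point, then on small neighbourhoods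
of this point the branch acts on integrals through multiplication by the value of the derivative. -/
lemma IsInverseBranchDeriv.tendsto_setIntegral {X : Type*} [MetricSpace X] [MeasurableSpace X]
    [BorelSpace X] {μ : Measure X} [IsFiniteMeasure μ] {T : X → X} (hT : Measurable T) {n : ℕ}
    {C : Set X} {w : X → ℝ} (hw : IsInverseBranchDeriv μ T n C w)
    (hwc : ContinuousOn w (T^[n] '' C)) {x : X} {A : ℕ → Set X} {δ : ℕ → ℝ}
    (hδ : Tendsto δ atTop (𝓝 0)) (hAδ : ∀ l, ∀ y ∈ A l, dist y x ≤ δ l)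
    (hx : x ∈ T^[n] '' C) (hA : ∀ l, MeasurableSet (A l)) (hA0 : ∀ l, μ (A l) ≠ 0)
    (hAC : ∀ᶠ l in atTop, A l ⊆ T^[n] '' C) (G : ℕ → X → ℝ) (hGm : ∀ l, Measurable (G l))
    (hG : ∀ l y, G l y ∈ Icc (0 : ℝ) 1) :
    Tendsto (fun l => (μ.real (A l))⁻¹ * (∫ y in C ∩ T^[n] ⁻¹' A l, G l (T^[n] y) ∂μ) -
      w x * ((μ.real (A l))⁻¹ * ∫ y in A l, G l y ∂μ)) atTop (𝓝 0) := by
  rw [Metric.tendsto_atTop']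
  intro ε hε
  obtain ⟨η, hη, hwη⟩ := Metric.continuousWithinAt_iff.1 (hwc x hx) (ε / 2) (by positivity)
  obtain ⟨N, hN⟩ := eventually_atTop.1 (hAC.and (hδ.eventually_lt_const hη))
  refine ⟨N, fun l hl => ?_⟩
  obtain ⟨hsub, hδl⟩ := hN l hl.le
  have hclose : ∀ y ∈ A l, |w y - w x| ≤ ε / 2 := fun y hy =>
    (hwη (hsub hy) ((hAδ l y hy).trans_lt hδl)).le
  have hpos : 0 < μ.real (A l) := ENNReal.toReal_pos (hA0 l) (measure_ne_top _ _)
  have hwm : AEMeasurable w (μ.restrict (A l)) := (hwc.mono hsub).aemeasurable (hA l)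
  have h1 : ∫ y in C ∩ T^[n] ⁻¹' A l, G l (T^[n] y) ∂μ = ∫ y in A l, w y * G l y ∂μ := by
    rw [← integral_map (f := G l) (hT.iterate n).aemeasurable (hGm l).aestronglyMeasurable,
      hw.map_restrict_eq hT (hA l) hsub,
      integral_withDensity_eq_integral_toReal_smul₀ hwm.ennreal_ofReal
        (ae_of_all _ fun _ => ENNReal.ofReal_lt_top)]
    refine setIntegral_congr_fun (hA l) fun y hy => ?_
    simp only [ENNReal.toReal_ofReal (hw.1 y (hsub hy)).le, smul_eq_mul]
  have hint : IntegrableOn (fun y => w y * G l y) (A l) μ := by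
    refine Integrable.of_bound (hwm.mul (hGm l).aemeasurable).aestronglyMeasurable
      (|w x| + ε / 2) ?_
    filter_upwards [ae_restrict_mem (hA l)] with y hy
    have h2 : |w y| ≤ |w x| + ε / 2 := by
      have := abs_sub_abs_le_abs_sub (w y) (w x)
      linarith [hclose y hy]
    rw [norm_mul, Real.norm_eq_abs, Real.norm_of_nonneg (hG l y).1]
    exact (mul_le_of_le_one_right (abs_nonneg _) (hG l y).2).trans h2
  have hint2 : IntegrableOn (fun y => w x * G l y) (A l) μ :=
    (Integrable.of_bound (hGm l).aestronglyMeasurable 1 (ae_of_all _ fun y => by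
      rw [Real.norm_of_nonneg (hG l y).1]; exact (hG l y).2)).const_mul (w x)
  have h3 : |(∫ y in A l, w y * G l y ∂μ) - w x * ∫ y in A l, G l y ∂μ| ≤
      ε / 2 * μ.real (A l) := by
    rw [← integral_const_mul, ← integral_sub hint hint2]
    refine norm_setIntegral_le_of_norm_le_const (μ := μ) (s := A l)
      (f := fun y => w y * G l y - w x * G l y) (measure_lt_top μ (A l)) fun y hy => ?_
    rw [← sub_mul, norm_mul, Real.norm_of_nonneg (hG l y).1, Real.norm_eq_abs]
    exact (mul_le_of_le_one_right (abs_nonneg _) (hG l y).2).trans (hclose y hy)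
  rw [dist_zero_right, Real.norm_eq_abs, h1, show ∀ a b c d : ℝ, a * b - c * (a * d) =
    a * (b - c * d) from fun a b c d => by ring, abs_mul, abs_of_pos (inv_pos.2 hpos),
    inv_mul_eq_div, div_lt_iff₀ hpos]
  exact h3.trans_lt (mul_lt_mul_of_pos_right (by linarith) hpos)

/-! ### Limit theorems for the cylinders of an infinite word -/

section

variable {X : Type*} [MetricSpace X] [MeasurableSpace X] [BorelSpace X] {μ : Measure X}
  [IsProbabilityMeasure μ] {T : X → X} {ξ : Set (Set X)} {δ κ : ℕ → ℝ} {K : ℝ}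
  {z : ℕ → Set X} {x : X}

omit [BorelSpace X] [IsProbabilityMeasure μ] in
lemma HasCylinderBounds.measure_ne_zero [NeZero μ] (h : HasCylinderBounds μ T ξ δ κ K)
    (hz : ∀ i, z i ∈ ξ) (hx : ∀ n, x ∈ wordCyl T z n) (n : ℕ) : μ (wordCyl T z n) ≠ 0 := by
  rcases Nat.eq_zero_or_pos n with rfl | hn
  · simpa [wordCyl_zero] using NeZero.ne μ
  · exact (h.measure_pos z hz n hn ⟨x, hx n⟩).ne'

lemma HasCylinderBounds.tendsto_measure (h : HasCylinderBounds μ T ξ δ κ K)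
    (hT : Measurable T) (hP : IsPiecewiseInvertible μ T ξ) (hat : ∀ y, μ {y} = 0)
    (hz : ∀ i, z i ∈ ξ) (hx : ∀ n, x ∈ wordCyl T z n) :
    Tendsto (fun l => μ (wordCyl T z l)) atTop (𝓝 0) := by
  obtain ⟨m₀, hm₀, hdecay⟩ := h.exists_measureReal_add_le hT hP hat hz hx
  exact (ENNReal.tendsto_toReal_iff (fun l => measure_ne_top _ _) ENNReal.zero_ne_top).1
    (summable_and_tendsto_of_halving (f := fun l => μ.real (wordCyl T z l))
      (fun l => measureReal_nonneg) hm₀ (hdecay m₀ le_rfl)).1.tendsto_atTop_zero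

theorem HasCylinderBounds.poissonAsymptotics (h : HasCylinderBounds μ T ξ δ κ K)
    (hT : Ergodic T μ) (hP : IsPiecewiseInvertible μ T ξ) (hz : ∀ i, z i ∈ ξ)
    (hx : ∀ n, x ∈ wordCyl T z n) (hxp : x ∉ Function.periodicPts T) :
    PoissonAsymptotics μ T (wordCyl T z) := by
  have hmp := hT.toMeasurePreserving
  have hTm := hmp.measurable
  have hat := h.measure_singleton hT hz hx (Or.inl hxp)
  have hA : ∀ n, MeasurableSet (wordCyl T z n) :=
    measurableSet_wordCyl hTm fun i => (hP.isOpen _ (hz i)).measurableSet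
  have hA0 := h.measure_ne_zero hz hx
  have hlim := h.tendsto_measure hTm hP hat hz hx
  have := isProbabilityMeasure_expLaw zero_lt_one
  -- At a non-periodic point nothing need be removed: every fixed return time is eventually
  -- impossible. So θ = 1, and return and hitting transforms have the same limit.
  have hmix := h.tendsto_setIntegral_laplaceMonomial hT hP hat hz hx (E := fun _ => univ)
    (fun _ => .univ) (p := 0) (fun l z' _ m _ => Or.inl (subset_univ _)) (fun j hj => by
      filter_upwards [h.eventually_notMem_of_iterate_ne hz hx (j := j)
        fun hper => hxp ⟨j, hj, hper⟩] with l hl y hy using hl y hy.1) (θ := 1) (by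
      simp only [preimage_univ, inter_univ]
      refine tendsto_const_nhds.congr fun l => (inv_mul_cancel₀ ?_).symm
      exact (ENNReal.toReal_pos (hA0 l) (measure_ne_top _ _)).ne')
  simp only [preimage_univ, inter_univ, one_mul] at hmix
  have hret := tendsto_return_laplace hmp (Eventually.of_forall hA) (Eventually.of_forall hA0)
    hlim zero_lt_one fun s L => by simpa using hmix s L
  have hval : ∀ s : ℕ, ∫ t, expNeg t ^ s ∂(expLaw 1) = (1 - 1) + 1 * (1 / ((s : ℝ) + 1)) := by
    intro s
    rw [integral_expNeg_pow_expLaw zero_lt_one]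
    ring
  have hprob : ∀ l, IsProbabilityMeasure μ[|wordCyl T z l] := fun l =>
    cond_isProbabilityMeasure (hA0 l)
  refine ⟨convergesInLaw_hitProcess_of_laplace hTm hA _ _ fun L => ?_,
    convergesInLaw_hitProcess_of_laplace hTm hA _ _ fun L => ?_⟩
  · simp only [hval]
    rcases L with _ | ⟨s, L⟩
    · simp [laplaceMonomial]
    · have := (hret (s :: L)).sub (hmix s L)
      simpa using this
  · simp only [hval, integral_cond_eq]
    exact hret L

omit [MetricSpace X] [MeasurableSpace X] [BorelSpace X] in
lemma letter_periodic (hd : ξ.PairwiseDisjoint id) (hz : ∀ i, z i ∈ ξ)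
    (hx : ∀ n, x ∈ wordCyl T z n) {j : ℕ} (hj : T^[j] x = x) : (fun i => z (j + i)) = z := by
  funext i
  refine eq_of_mem_partition hd (hz _) (hz i) (x := T^[i] x) ?_ (hx (i + 1) i (by omega))
  have h1 := hx (j + i + 1) (j + i) (by omega)
  rwa [add_comm j i, Function.iterate_add_apply, hj, add_comm i j] at h1

/-- Split A_l into A_{p+l}, whose points return after exactly p steps for large l, and the rest. The
first part, of asymptotic proportion w(x), restarts the return process after a negligible time; the
second behaves like the hitting process. -/
theorem HasCylinderBounds.compound_law (h : HasCylinderBounds μ T ξ δ κ K)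
    (hT : Ergodic T μ) (hP : IsPiecewiseInvertible μ T ξ)
    (hM : ∀ Z ∈ ξ, ∀ Z' ∈ ξ, (T '' Z ∩ Z').Nonempty → Z' ⊆ T '' Z) (hz : ∀ i, z i ∈ ξ)
    (hx : ∀ n, x ∈ wordCyl T z n) (hxp : x ∈ Function.periodicPts T) (hx0 : μ {x} = 0)
    {w : X → ℝ} (hw : IsInverseBranchDeriv μ T (Function.minimalPeriod T x)
      (wordCyl T z (Function.minimalPeriod T x)) w)
    (hwc : ContinuousOn w
      (T^[Function.minimalPeriod T x] '' wordCyl T z (Function.minimalPeriod T x))) :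
    1 - w x ∈ Ioo (0 : ℝ) 1 ∧
      ConvergesInLaw (fun l => μ[|wordCyl T z l]) (fun l => hitProcess μ T (wordCyl T z l))
        (iidLaw (compoundExpLaw (1 - w x))) := by
  have hmp := hT.toMeasurePreserving
  have hTm := hmp.measurable
  have hat := h.measure_singleton hT hz hx (Or.inr hx0)
  have hA : ∀ n, MeasurableSet (wordCyl T z n) :=
    measurableSet_wordCyl hTm fun i => (hP.isOpen _ (hz i)).measurableSet
  have hA0 := h.measure_ne_zero hz hx
  have hlim := h.tendsto_measure hTm hP hat hz hx
  have hApos : ∀ l, 0 < μ.real (wordCyl T z l) := fun l =>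
    ENNReal.toReal_pos (hA0 l) (measure_ne_top _ _)
  set p := Function.minimalPeriod T x
  have hp : 0 < p := Function.minimalPeriod_pos_of_mem_periodicPts hxp
  have hpx : T^[p] x = x := Function.iterate_minimalPeriod
  set A := wordCyl T z with hAdef
  have hadd : ∀ l, A (p + l) = A p ∩ T^[p] ⁻¹' A l := by
    intro l
    rw [hAdef, wordCyl_add, letter_periodic hP.disjoint hz hx hpx]
  have hxim : x ∈ T^[p] '' A p := ⟨x, hx p, hpx⟩
  have hsub : ∀ l, 1 ≤ l → A l ⊆ T^[p] '' A p := by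
    intro l hl
    obtain ⟨k, hk⟩ : ∃ k, p = k + 1 := ⟨p - 1, by omega⟩
    rw [hk] at hxim ⊢
    rw [hAdef, iterate_image_wordCyl hM hz ⟨x, hx _⟩] at *
    exact wordCyl_subset_image hM (hz k) hz hl (hx l) hxim
  have hbranch := hw.tendsto_setIntegral hTm hwc (x := x) (A := A) h.tendsto_diam
    (fun l y hy => h.diam_le z hz l y hy x (hx l)) hxim hA hA0
    ((eventually_ge_atTop 1).mono hsub)
  -- the proportion of points of `A l` returning after `p` steps
  have hratio : Tendsto (fun l => μ.real (A (p + l)) / μ.real (A l)) atTop (𝓝 (w x)) := by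
    have h1 := (hbranch (fun _ _ => 1) (fun _ => measurable_const)
      fun _ _ => ⟨zero_le_one, le_rfl⟩).add_const (w x)
    rw [zero_add] at h1
    refine h1.congr fun l => ?_
    have := (hApos l).ne'
    rw [← hadd]
    simp only [integral_const, measureReal_restrict_apply_univ, smul_eq_mul, mul_one]
    rw [inv_mul_cancel₀ this]
    ring
  have hwpos : 0 < w x := hw.1 x hxim
  have hwlt : w x < 1 := by
    obtain ⟨m₀, hm₀, hdecay⟩ := h.exists_measureReal_add_le hTm hP hat hz hx
    -- Iterating the ratio limit identifies w(x)^k as the asymptotic proportion of A_{l+kp} in A_l.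
    -- With k = m₀ we have kp ≥ m₀, so the decay bound forces w(x)^k ≤ 1/2, hence w(x) < 1.
    have hpow : ∀ k, Tendsto (fun l => μ.real (A (l + k * p)) / μ.real (A l)) atTop
        (𝓝 (w x ^ k)) := by
      intro k
      induction k with
      | zero =>
        refine tendsto_const_nhds.congr fun l => ?_
        simp [(hApos l).ne']
      | succ k ih =>
        rw [pow_succ]
        refine (ih.mul (hratio.comp (tendsto_add_atTop_nat (k * p)))).congr fun l => ?_
        have h1 := (hApos l).ne'
        have h2 := (hApos (l + k * p)).ne'
        simp only [Function.comp_apply]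
        rw [show l + (k + 1) * p = p + (l + k * p) by ring]
        field_simp
    by_contra hge
    have h1 : w x ^ m₀ ≤ 1 / 2 := by
      refine le_of_tendsto (hpow m₀) ?_
      filter_upwards [eventually_ge_atTop 1] with l hl
      rw [div_le_iff₀ (hApos l)]
      exact hdecay _ (Nat.le_mul_of_pos_right m₀ hp) l hl
    have h2 := one_le_pow₀ (not_lt.1 hge) (n := m₀)
    linarith
  refine ⟨⟨by linarith, by linarith⟩, ?_⟩
  -- Membership of A_l \ A_{p+l} depends only on the p letters read from time l on, so E_l is
  -- resolved by every cylinder of rank at least p.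
  set E : ℕ → Set X := fun l => (wordCyl T (fun i => z (l + i)) p)ᶜ
  have hDeq : ∀ l, A l ∩ T^[l] ⁻¹' E l = A l \ A (p + l) := by
    intro l
    rw [add_comm p l, hAdef, wordCyl_add, preimage_compl]
    ext y
    simp
  have hEp : ∀ l, ∀ z' : ℕ → Set X, (∀ i, z' i ∈ ξ) → ∀ m, p ≤ m →
      wordCyl T z' m ⊆ E l ∨ Disjoint (wordCyl T z' m) (E l) := by
    intro l z' hz' m hm
    by_cases hdis : Disjoint (wordCyl T z' m) (wordCyl T (fun i => z (l + i)) p)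
    · exact Or.inl hdis.subset_compl_right
    · obtain ⟨y, hy1, hy2⟩ := not_disjoint_iff.1 hdis
      refine Or.inr (disjoint_compl_right_iff_subset.2 ?_)
      rw [← wordCyl_eq_of_mem hP.disjoint hz' (fun i => hz _) (wordCyl_antitone T z' hm hy1) hy2]
      exact wordCyl_antitone T z' hm
  have hret : ∀ j, 1 ≤ j → ∀ᶠ l in atTop, ∀ y ∈ A l ∩ T^[l] ⁻¹' E l, T^[j] y ∉ A l := by
    intro j hj
    -- If j is a period of x and j ≤ l, returning at time j forces y ∈ A_{j+l} ⊆ A_{p+l}, a part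
    -- already removed. Other times are excluded because x itself does not return then.
    by_cases hjx : T^[j] x = x
    · filter_upwards [eventually_ge_atTop j] with l hl y hy hyj
      rw [hDeq] at hy
      have hpj : p ≤ j := Function.IsPeriodicPt.minimalPeriod_le hj hjx
      have h1 : y ∈ A (j + l) := by
        rw [hAdef, wordCyl_add, letter_periodic hP.disjoint hz hx hjx]
        exact ⟨wordCyl_antitone T z hl hy.1, hyj⟩
      exact hy.2 (wordCyl_antitone T z (by omega) h1)
    · filter_upwards [h.eventually_notMem_of_iterate_ne hz hx hjx] with l hl y hy using hl y hy.1
  have hθ : Tendsto (fun l => (μ.real (A l))⁻¹ * μ.real (A l ∩ T^[l] ⁻¹' E l)) atTop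
      (𝓝 (1 - w x)) := by
    refine (hratio.const_sub 1).congr fun l => ?_
    have h1 := (hApos l).ne'
    have hle : A (p + l) ⊆ A l := wordCyl_antitone T z (by omega)
    rw [hDeq, measureReal_sdiff hle (hA _)]
    field_simp
  have hlate : ∀ s L, Tendsto (fun l => (μ.real (A l))⁻¹ * (∫ y in A l ∩ T^[l] ⁻¹' E l,
      laplaceMonomial (s :: L) (hitProcess μ T (A l) y) ∂μ) -
      (1 - w x) * ∫ y, laplaceMonomial (s :: L) (hitProcess μ T (A l) y) ∂μ) atTop (𝓝 0) :=
    h.tendsto_setIntegral_laplaceMonomial hT hP hat hz hx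
    (fun l => (measurableSet_wordCyl hTm (fun i => (hP.isOpen _ (hz _)).measurableSet) p).compl)
    hEp hret hθ
  have hearly : ∀ s L, Tendsto (fun l => (μ.real (A l))⁻¹ *
      (∫ y in A (p + l), laplaceMonomial (s :: L) (hitProcess μ T (A l) y) ∂μ) -
      w x * ((μ.real (A l))⁻¹ * ∫ y in A l, laplaceMonomial L (hitProcess μ T (A l) y) ∂μ))
      atTop (𝓝 0) := by
    intro s L
    set G : ℕ → X → ℝ := fun l y => laplaceMonomial L (hitProcess μ T (A l) y)
    have hGm : ∀ l, Measurable (G l) := fun l =>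
      measurable_laplaceMonomial_hitProcess μ hTm (hA l) L
    have hG : ∀ l y, G l y ∈ Icc (0 : ℝ) 1 := fun l y =>
      ⟨laplaceMonomial_nonneg _ _, laplaceMonomial_le_one _ _⟩
    have h1 := hbranch G hGm hG
    have hq : Tendsto (fun l => (expNeg (μ (A l)) ^ s) ^ p - 1) atTop (𝓝 0) := by
      simpa using ((tendsto_expNeg_pow hlim s).pow p).sub_const 1
    have h2 : Tendsto (fun l => ((expNeg (μ (A l)) ^ s) ^ p - 1) *
        ((μ.real (A l))⁻¹ * ∫ y in A p ∩ T^[p] ⁻¹' A l, G l (T^[p] y) ∂μ)) atTop (𝓝 0) := by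
      refine squeeze_zero_norm (fun l => ?_) (by simpa using hq.norm)
      rw [norm_mul]
      refine mul_le_of_le_one_right (norm_nonneg _) ?_
      have h3 : ‖∫ y in A p ∩ T^[p] ⁻¹' A l, G l (T^[p] y) ∂μ‖ ≤ 1 * μ.real (A l) := by
        refine (norm_setIntegral_le_of_norm_le_const (C := 1) (measure_lt_top _ _)
          fun y _ => ?_).trans ?_
        · rw [Real.norm_of_nonneg (hG l _).1]
          exact (hG l _).2
        · rw [← hadd]
          gcongr
          · exact measure_ne_top _ _
          · exact wordCyl_antitone T z (by omega)
      rw [norm_mul, norm_inv, Real.norm_of_nonneg (hApos l).le, inv_mul_le_iff₀ (hApos l)]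
      linarith
    -- Minimality of p rules out earlier returns, so on A_{p+l} the first return time is exactly p;
    -- its factor q^p tends to 1.
    have hev : ∀ᶠ l in atTop, ∀ j ∈ Ico 1 p, ∀ y ∈ A l, T^[j] y ∉ A l := by
      refine (Filter.eventually_all_finite (finite_Ico 1 p)).2 fun j hj =>
        h.eventually_notMem_of_iterate_ne hz hx fun hjx => ?_
      exact (Function.IsPeriodicPt.minimalPeriod_le hj.1 hjx).not_gt hj.2
    have h3 := h1.add h2
    rw [add_zero] at h3
    refine h3.congr' ?_
    filter_upwards [hev] with l hl
    have h4 : ∫ y in A (p + l), laplaceMonomial (s :: L) (hitProcess μ T (A l) y) ∂μ =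
        (expNeg (μ (A l)) ^ s) ^ p * ∫ y in A p ∩ T^[p] ⁻¹' A l, G l (T^[p] y) ∂μ := by
      rw [← integral_const_mul, ← hadd]
      refine setIntegral_congr_fun (hA _) fun y hy => ?_
      have hyA : y ∈ A l := wordCyl_antitone T z (by omega) hy
      rw [hadd] at hy
      exact laplaceMonomial_hitProcess_first (hA0 l) L s hp
        (fun j h1 h2 => hl j ⟨h1, h2⟩ y hyA) hy.2
    rw [h4]
    ring
  have hlap := tendsto_return_laplace hmp (Eventually.of_forall hA) (Eventually.of_forall hA0)
    hlim (θ := 1 - w x) (by linarith) fun s L => by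
      have h1 := (hlate s L).add (hearly s L)
      rw [add_zero] at h1
      refine h1.congr fun l => ?_
      have hint := integrable_laplaceMonomial_hitProcess μ μ hTm (hA l) (s :: L)
      have hle : A (p + l) ⊆ A l := wordCyl_antitone T z (by omega)
      have h2 := setIntegral_sdiff (hA (p + l)) hint.integrableOn hle
      rw [hDeq l, h2]
      ring
  have := isProbabilityMeasure_compoundExpLaw (θ := 1 - w x) (by linarith) (by linarith)
  have hprob : ∀ l, IsProbabilityMeasure μ[|A l] := fun l => cond_isProbabilityMeasure (hA0 l)
  refine convergesInLaw_hitProcess_of_laplace hTm hA _ _ fun L => ?_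
  simp only [integral_expNeg_pow_compoundExpLaw (θ := 1 - w x) (by linarith) (by linarith),
    integral_cond_eq]
  exact hlap L

end

end

end RareEvents

end

open RareEvents
theorem mainTheorem11 {X : Type*} [MetricSpace X] [MeasurableSpace X] [BorelSpace X]
    (μ : Measure X) (T : X → X) (ξ : Set (Set X)) (hGM : IsErgodicGibbsMarkov μ T ξ)
    (xstar : X) (A : ℕ → Set X)
    (hA : ∀ l : ℕ, 1 ≤ l → A l ∈ cylinders T ξ l ∧ xstar ∈ A l) :
    (xstar ∉ Function.periodicPts T → PoissonAsymptotics μ T A) ∧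
    (xstar ∈ Function.periodicPts T → μ {xstar} = 0 →
      ∀ p : ℕ, p = Function.minimalPeriod T xstar →
        (∃ w : X → ℝ, IsInverseBranchDeriv μ T p (A p) w ∧ ContinuousOn w (T^[p] '' A p)) ∧
        ∀ w : X → ℝ, IsInverseBranchDeriv μ T p (A p) w → ContinuousOn w (T^[p] '' A p) →
          1 - w xstar ∈ Ioo (0 : ℝ) 1 ∧
          ConvergesInLaw (fun l => μ[|A l]) (fun l => hitProcess μ T (A l))
            (iidLaw (compoundExpLaw (1 - w xstar)))) := by
  have := hGM.isProbability
  have hP := hGM.piecewiseInvertible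
  obtain ⟨δ, κ, K, h⟩ := hGM.exists_hasCylinderBounds
  obtain ⟨z, hz, hx, hAz⟩ := exists_word_of_cylinders hP.disjoint hA
  -- The set `A 0` is unconstrained, so the sequences agree only from rank 1 on, which suffices for
  -- limits.
  have hev : ∀ᶠ l in atTop, wordCyl T z l = A l :=
    (eventually_ge_atTop 1).mono fun l hl => (hAz l hl).symm
  have hcond : ∀ᶠ l in atTop, μ[|wordCyl T z l] = μ[|A l] := hev.mono fun l hl => by rw [hl]
  have hhit : ∀ᶠ l in atTop, hitProcess μ T (wordCyl T z l) = hitProcess μ T (A l) :=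
    hev.mono fun l hl => by rw [hl]
  refine ⟨fun hxp => ?_, ?_⟩
  · obtain ⟨h1, h2⟩ := h.poissonAsymptotics hGM.ergodic hP hz hx hxp
    exact ⟨h1.congr' (Eventually.of_forall fun _ => rfl) hhit, h2.congr' hcond hhit⟩
  · rintro hxp hx0 p rfl
    have hp : 0 < Function.minimalPeriod T xstar :=
      Function.minimalPeriod_pos_of_mem_periodicPts hxp
    rw [hAz _ hp]
    refine ⟨h.deriv z hz _ hp ⟨xstar, hx _⟩, fun w hw hwc => ?_⟩
    obtain ⟨h1, h2⟩ := h.compound_law hGM.ergodic hP hGM.markov hz hx hxp hx0 hw hwc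
    exact ⟨h1, h2.congr' hcond hhit⟩
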